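/- For $\alpha\in[0,1)$ let $J_\alpha(n)=n^{-2+\alpha}$ for $n\ge 1$ (so $J_\alpha(1)=1$), and let $\alpha^*\in(0,1)$ be the number with $\sum_{k\ge1}k^{-2+\alpha^*}=2$. For $L\ge1$ put $$W_\alpha(L)=\sum_{x=1}^{L}\Big[\sum_{y\in[-L+1,0]\cup[L+1,2L]}J_\alpha(|x-y|)-\sum_{y\le -L\ \text{or}\ y\ge 2L+1}J_\alpha(|x-y|)\Big],$$ $\chi_\alpha(L)=L^\alpha$ if $\alpha>0$, and $\chi_0(L)=\log L+4$. *Triangles.* Fix roots $r_i\in[i-\frac1{100},i+\frac1{100}]$, $i\in\mathbb Z+\frac12$, with $|r_{i_1}-r_{i_2}|\ne|r_{i_3}-r_{i_4}|$ for distinct $i_1,\dots,i_4$. Let $\Lambda=[-N,N]\cap\mathbb Z$ with $N\ge1$, and let $\sigma\in\{-1,1\}^{\mathbb Z}$ be $+1$ outside $\Lambda$. Its spin-flip points are the $i$ with $\sigma_{i-1/2}\neq\sigma_{i+1/2}$. Repeatedly take two remaining spin-flip points whose roots are at the smallest distance, join them by a triangle $T$, and remove them. This gives the family of triangles $\underline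 T(\sigma)$; families of this form are called compatible. For a triangle $T$ with spin-flip points $i<j$ let $\Delta(T)=[i,j]\cap\mathbb Z$ and $|T|=|\Delta(T)|$; let $d(T,T')$ be the distance between the sets of the two spin-flip points of $T$ and of $T'$. *Contours.* For a set $\Gamma$ of triangles put $\Delta(\Gamma)=\bigcup_{T\in\Gamma}\Delta(T)$, $|\Gamma|=\sum_{T\in\Gamma}|T|$, $\|\Gamma\|_\alpha=\sum_{T\in\Gamma}\chi_\alpha(|T|)$. Let $c>1$. The contour map $\underline T\mapsto\underline\Gamma(\underline T)$ sends each compatible family to a partition of it, whose blocks are called contours, such that: - (P.1) any two distinct contours $\Gamma,\Gamma'\in\underline\Gamma(\underline T)$ satisfy $\min_{T\in\Gamma,T'\in\Gamma'}d(T,T')>c\min\{|\Gamma|,|\Gamma'|\}^3$, and either $\Delta(\Gamma)\cap\Delta(\Gamma')=\emptyset$, or one base is contained in the other, say $\Delta(\Gamma)\subseteq\Delta(\Gamma')$, and then for each $T\in\Gamma'$ either $\Delta(\Gamma)\subseteq\Delta(T)$ or $\Delta(\Gamma)\cap\Delta(T)=\emptyset$; - (P.2) if the contours of compatible families $\underline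 T^{(1)},\dots,\underline T^{(k)}$ with compatible union satisfy the condition in (P.1) for every pair of contours taken from two different families, then $\underline\Gamma(\bigcup_i\underline T^{(i)})=\bigcup_i\underline\Gamma(\underline T^{(i)})$. For a family $\underline\Gamma$ of contours let $\sigma_x(\underline\Gamma)=(-1)^{n_x}$, where $n_x$ is the number of triangles $T$ of contours of $\underline\Gamma$ with $x\in\Delta(T)$ (thus $\sigma(\underline\Gamma)=\sigma$ if $\underline\Gamma=\underline\Gamma(\underline T(\sigma))$), and let $$H_\alpha^+(\underline\Gamma)=\frac12\sum_{x\ne y}J_\alpha(|x-y|)\,\mathbf 1_{\sigma_x(\underline\Gamma)\ne\sigma_y(\underline\Gamma)},\qquad H^+_\alpha[\Gamma|\underline\Gamma\setminus\Gamma]=H^+_\alpha(\underline\Gamma)-H^+_\alpha(\underline\Gamma\setminus\{\Gamma\}).$$ **Corollary.** For every $\alpha\in[\alpha^*,1)$ there is $\alpha'\in[0,\alpha^*)$ with the following properties. There is a constant $\zeta>0$ such that $$W_{\alpha'}(L)\ge\zeta\,\chi_{\alpha'}(L)\quad\text{for all }L\ge1.\qquad(*)$$ There is also $c_0>1$ such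 that for every $c\ge c_0$, every choice of the roots, every $N\ge 1$, every contour configuration $\underline\Gamma=\underline\Gamma(\underline T(\sigma))$ with $\sigma=+1$ outside $[-N,N]$, every contour $\Gamma\in\underline\Gamma$, and every constant $\zeta_{\alpha'}>0$ satisfying $(*)$, $$H_\alpha^+(\Gamma)\ \ge\ \zeta_{\alpha'}\|\Gamma\|_{\alpha'}\qquad\text{and}\qquad H_\alpha^+[\Gamma|\underline\Gamma\setminus\Gamma]\ \ge\ \frac{\zeta_{\alpha'}}2\|\Gamma\|_{\alpha'}.$$ -/

import Mathlib

namespace LongRangeIsing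

noncomputable section

/-! ### The coupling, the function `W`, and the function `χ` -/

/-- The coupling constant `J(n) = n ^ (-2 + α)`, for `n ≥ 1`; in particular `J(1) = 1`. -/
def coupling (α : ℝ) (n : ℕ) : ℝ := (n : ℝ) ^ (-2 + α)

/-- `W_α(L)`: the interaction of `{1, …, L}` with the two adjacent intervals of length `L`, minus
its interaction with everything further away. -/
def W (α : ℝ) (L : ℕ) : ℝ :=
  ∑ x ∈ Finset.Icc (1 : ℤ) L,
    ((∑ y ∈ Finset.Icc ((L : ℤ) + 1) (2 * L) ∪ Finset.Icc (-(L : ℤ) + 1) 0,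
        coupling α (x - y).natAbs)
      - ∑' y : {y : ℤ // 2 * (L : ℤ) + 1 ≤ y ∨ y ≤ -(L : ℤ)}, coupling α (x - y.1).natAbs)

/-- `χ_α(L) = L ^ α` if `α ≠ 0`, and `χ_0(L) = log L + 4`. -/
def chi (α : ℝ) (L : ℕ) : ℝ := if α = 0 then Real.log L + 4 else (L : ℝ) ^ α

/-- `ζ` is a positive constant with `W_α(L) ≥ ζ χ_α(L)` for every `L ≥ 1`. -/
def IsLowerConstant (α ζ : ℝ) : Prop :=
  0 < ζ ∧ ∀ L : ℕ, 1 ≤ L → ζ * chi α L ≤ W α L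

/-! ### Triangles -/

/-- A triangle, recorded by its two spin-flip points. The integer `i` stands for the point
`i + 1/2` of the dual lattice, which lies between the sites `i` and `i + 1`. -/
@[ext]
structure Triangle where
  left : ℤ
  right : ℤ
  lt : left < right
  deriving DecidableEq

namespace Triangle

/-- `Δ(T)`: the sites between the two spin-flip points of `T`. -/
def base (T : Triangle) : Finset ℤ := Finset.Ioc T.left T.right

/-- `|T| = |Δ(T)|`. -/
def mass (T : Triangle) : ℕ := T.base.card

/-- The distance between the sets of spin-flip points of `T` and of `T'`. -/
def dist (T T' : Triangle) : ℕ :=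
  min (min (T.left - T'.left).natAbs (T.left - T'.right).natAbs)
    (min (T.right - T'.left).natAbs (T.right - T'.right).natAbs)

end Triangle

/-- `r` chooses for every dual point `i + 1/2` a root `r i` at distance at most `1/100` from it, so
that distances between disjoint pairs of roots are distinct. -/
structure IsRootChoice (r : ℤ → ℝ) : Prop where
  near : ∀ i : ℤ, r i ∈ Set.Icc ((i : ℝ) + 1 / 2 - 1 / 100) ((i : ℝ) + 1 / 2 + 1 / 100)
  generic : ∀ i₁ i₂ i₃ i₄ : ℤ, [i₁, i₂, i₃, i₄].Nodup → |r i₁ - r i₂| ≠ |r i₃ - r i₄|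

/-- With this choice of roots, `Δ(T)` is the set of integers between the two roots. -/
theorem mem_base_iff {r : ℤ → ℝ} (hr : IsRootChoice r) (T : Triangle) (x : ℤ) :
    x ∈ T.base ↔ (x : ℝ) ∈ Set.Icc (r T.left) (r T.right) := by
  have h1 := hr.near T.left
  have h2 := hr.near T.right
  simp only [Triangle.base, Finset.mem_Ioc, Set.mem_Icc] at *
  constructor
  · rintro ⟨h3, h4⟩
    have h3' : (T.left : ℝ) + 1 ≤ x := by exact_mod_cast h3
    have h4' : (x : ℝ) ≤ T.right := by exact_mod_cast h4
    constructor <;> linarith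
  · rintro ⟨h3, h4⟩
    constructor
    · by_contra h
      have : (x : ℝ) ≤ T.left := by exact_mod_cast not_lt.mp h
      linarith
    · by_contra h
      have : (T.right : ℝ) + 1 ≤ x := by exact_mod_cast not_le.mp h
      linarith

/-- `Triangulates r S F`: the triangle-growing process started from the spin-flip points `S`
produces the family `F`. At each step two remaining points whose roots are at the smallest distance
are joined by a triangle and removed. -/
inductive Triangulates (r : ℤ → ℝ) : Finset ℤ → Finset Triangle → Prop
  | nil : Triangulates r ∅ ∅
  | step (S : Finset ℤ) (F : Finset Triangle) (T : Triangle)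
      (hl : T.left ∈ S) (hr : T.right ∈ S)
      (hmin : ∀ i ∈ S, ∀ j ∈ S, i ≠ j → |r T.left - r T.right| ≤ |r i - r j|)
      (hF : Triangulates r (S \ {T.left, T.right}) F) :
      Triangulates r S (insert T F)

/-- `σ` is a spin configuration which is `+1` outside `[-N, N]`. -/
def IsPlusOutside (N : ℕ) (σ : ℤ → ℤˣ) : Prop :=
  ∀ x : ℤ, x ∉ Finset.Icc (-(N : ℤ)) N → σ x = 1

/-- The spin-flip points of `σ` (all of them, if `σ` is `+1` outside `[-N, N]`). -/
def flips (N : ℕ) (σ : ℤ → ℤˣ) : Finset ℤ :=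
  {i ∈ Finset.Icc (-(N : ℤ) - 1) N | σ i ≠ σ (i + 1)}

/-- `F` is a compatible family of triangles in `[-N, N]`: it is the family of triangles of some
spin configuration with plus boundary condition. -/
def IsCompatible (r : ℤ → ℝ) (N : ℕ) (F : Finset Triangle) : Prop :=
  ∃ σ : ℤ → ℤˣ, IsPlusOutside N σ ∧ Triangulates r (flips N σ) F

/-! ### Contours -/

/-- `Δ(Γ)`. -/
def contourBase (Γ : Finset Triangle) : Finset ℤ := Γ.biUnion Triangle.base

/-- `|Γ|`. -/
def contourMass (Γ : Finset Triangle) : ℕ := ∑ T ∈ Γ, T.mass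

/-- `Δ(Γ) ⊆ Δ(Γ')`, and `Δ(Γ)` is contained in or disjoint from the base of each triangle
of `Γ'`. -/
def IsNested (Γ Γ' : Finset Triangle) : Prop :=
  contourBase Γ ⊆ contourBase Γ' ∧
    ∀ T ∈ Γ', contourBase Γ ⊆ T.base ∨ Disjoint (contourBase Γ) T.base

/-- Property P.1 for the pair `Γ`, `Γ'`: their bases are disjoint or nested, and
`d(Γ, Γ') > c min (|Γ|, |Γ'|) ^ 3`, where `d(Γ, Γ')` is the least distance between a triangle of
`Γ` and a triangle of `Γ'`. -/
def WellSeparated (c : ℝ) (Γ Γ' : Finset Triangle) : Prop :=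
  (Disjoint (contourBase Γ) (contourBase Γ') ∨ IsNested Γ Γ' ∨ IsNested Γ' Γ) ∧
    ∀ T ∈ Γ, ∀ T' ∈ Γ',
      c * (min (contourMass Γ) (contourMass Γ') : ℝ) ^ 3 < (Triangle.dist T T' : ℝ)

/-- `G` is the contour map with constant `c` on compatible families of triangles in `[-N, N]`: it
sends each such family to a partition of it (P.0) into pairwise well-separated blocks, the contours
(P.1), and the contours of several families taken together are the contours of the single families
as soon as these are well separated (P.2). -/
structure IsContourMap (r : ℤ → ℝ) (N : ℕ) (c : ℝ)
    (G : (F : Finset Triangle) → Finpartition F) : Prop where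
  separated : ∀ F, IsCompatible r N F → ∀ Γ ∈ (G F).parts, ∀ Γ' ∈ (G F).parts, Γ ≠ Γ' →
    WellSeparated c Γ Γ'
  independent : ∀ (k : ℕ) (F : Fin k → Finset Triangle), (∀ i, IsCompatible r N (F i)) →
    IsCompatible r N (Finset.univ.biUnion F) →
    (∀ i i', i ≠ i' → ∀ Γ ∈ (G (F i)).parts, ∀ Γ' ∈ (G (F i')).parts, WellSeparated c Γ Γ') →
    (G (Finset.univ.biUnion F)).parts = Finset.univ.biUnion fun i => (G (F i)).parts

/-- `‖Γ‖_α = ∑_{T ∈ Γ} χ_α(|T|)`. -/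
def contourNorm (α : ℝ) (Γ : Finset Triangle) : ℝ := ∑ T ∈ Γ, chi α T.mass

/-! ### The Hamiltonian -/

/-- The spin configuration determined by a family of triangles: `+1` far away, and the sign changes
at each spin-flip point. -/
def spin (F : Finset Triangle) (x : ℤ) : ℤˣ := (-1) ^ ({T ∈ F | x ∈ T.base}).card

/-- The zero-field Hamiltonian `H_α⁺(C)` of a family `C` of contours. -/
def hamiltonian (α : ℝ) (C : Finset (Finset Triangle)) : ℝ :=
  1 / 2 * ∑' p : ℤ × ℤ,
    if p.1 ≠ p.2 ∧ spin (C.biUnion id) p.1 ≠ spin (C.biUnion id) p.2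
      then coupling α (p.1 - p.2).natAbs else 0

/-- `H_α⁺(Γ | C ∖ Γ) = H_α⁺(C) - H_α⁺(C ∖ {Γ})`. -/
def condHamiltonian (α : ℝ) (Γ : Finset Triangle) (C : Finset (Finset Triangle)) : ℝ :=
  hamiltonian α C - hamiltonian α (C \ {Γ})

/-! ### Contour maps exist, and `spin` inverts the construction of triangles -/

/-- Property P.1 passes to subfamilies. -/
theorem WellSeparated.mono {c : ℝ} (hc : 0 ≤ c) {Γ Γ' A B : Finset Triangle}
    (h : WellSeparated c Γ Γ') (hA : A ⊆ Γ) (hB : B ⊆ Γ') : WellSeparated c A B := by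
  obtain ⟨h1, h2⟩ := h
  have bA : contourBase A ⊆ contourBase Γ := Finset.biUnion_subset_biUnion_of_subset_left _ hA
  have bB : contourBase B ⊆ contourBase Γ' := Finset.biUnion_subset_biUnion_of_subset_left _ hB
  have key : ∀ {X Y P Q : Finset Triangle}, contourBase P ⊆ contourBase X → Q ⊆ Y →
      IsNested X Y → Disjoint (contourBase P) (contourBase Q) ∨ IsNested P Q := by
    intro X Y P Q hP hQ hn
    by_cases hx : ∃ T ∈ Q, contourBase X ⊆ T.base
    · right
      obtain ⟨T, hT, hXT⟩ := hx
      refine ⟨(hP.trans hXT).trans (Finset.subset_biUnion_of_mem Triangle.base hT), ?_⟩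
      intro S hS
      rcases hn.2 S (hQ hS) with h | h
      · exact Or.inl (hP.trans h)
      · exact Or.inr (Finset.disjoint_of_subset_left hP h)
    · left
      rw [contourBase.eq_1 Q, Finset.disjoint_biUnion_right]
      intro T hT
      rcases hn.2 T (hQ hT) with h | h
      · exact absurd ⟨T, hT, h⟩ hx
      · exact Finset.disjoint_of_subset_left hP h
  constructor
  · rcases h1 with h | h | h
    · exact Or.inl (Finset.disjoint_of_subset_left bA (Finset.disjoint_of_subset_right bB h))
    · rcases key bA hB h with h | h
      · exact Or.inl h
      · exact Or.inr (Or.inl h)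
    · rcases key bB hA h with h | h
      · exact Or.inl h.symm
      · exact Or.inr (Or.inr h)
  · intro T hT T' hT'
    refine lt_of_le_of_lt ?_ (h2 T (hA hT) T' (hB hT'))
    have m1 : (contourMass A : ℝ) ≤ contourMass Γ := by
      exact_mod_cast Finset.sum_le_sum_of_subset hA
    have m2 : (contourMass B : ℝ) ≤ contourMass Γ' := by
      exact_mod_cast Finset.sum_le_sum_of_subset hB
    gcongr

/-- All pairs of distinct blocks of a partition have property P.1. -/
def IsSeparated (c : ℝ) {F : Finset Triangle} (P : Finpartition F) : Prop :=
  ∀ Γ ∈ P.parts, ∀ Γ' ∈ P.parts, Γ ≠ Γ' → WellSeparated c Γ Γ'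

/-- Two triangles are equivalent if no partition with property P.1 separates them. -/
def contourSetoid (c : ℝ) (F : Finset Triangle) : Setoid Triangle where
  r T T' := ∀ P : Finpartition F, IsSeparated c P → P.part T = P.part T'
  iseqv := ⟨fun _ _ _ => rfl, fun h P hP => (h P hP).symm,
    fun h h' P hP => (h P hP).trans (h' P hP)⟩

open scoped Classical in
/-- The finest partition with property P.1. -/
def contours (c : ℝ) (F : Finset Triangle) : Finpartition F :=
  Finpartition.ofSetSetoid (contourSetoid c F) F

theorem mem_part_contours {c : ℝ} {F : Finset Triangle} {a b : Triangle} :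
    b ∈ (contours c F).part a ↔ a ∈ F ∧ b ∈ F ∧
      ∀ P : Finpartition F, IsSeparated c P → P.part a = P.part b := by
  classical
  exact Finpartition.mem_part_ofSetSetoid_iff_rel F

theorem isSeparated_contours {c : ℝ} (hc : 0 ≤ c) (F : Finset Triangle) :
    IsSeparated c (contours c F) := by
  intro Γ hΓ Γ' hΓ' hne
  obtain ⟨a, ha⟩ := (contours c F).nonempty_of_mem_parts hΓ
  obtain ⟨b, hb⟩ := (contours c F).nonempty_of_mem_parts hΓ'
  have haF := (contours c F).le hΓ ha
  have hbF := (contours c F).le hΓ' hb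
  have ea := (contours c F).part_eq_of_mem hΓ ha
  have eb := (contours c F).part_eq_of_mem hΓ' hb
  have hnot : ¬ ∀ P : Finpartition F, IsSeparated c P → P.part a = P.part b := by
    intro h
    apply hne
    have : b ∈ (contours c F).part a := mem_part_contours.2 ⟨haF, hbF, h⟩
    rw [ea] at this
    exact ((contours c F).part_eq_of_mem hΓ this).symm.trans eb
  push Not at hnot
  obtain ⟨P, hP, hab⟩ := hnot
  refine WellSeparated.mono hc
    (hP _ (P.part_mem.2 haF) _ (P.part_mem.2 hbF) hab) ?_ ?_
  · intro t ht
    rw [← ea, mem_part_contours] at ht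
    rw [ht.2.2 P hP]
    exact P.mem_part ht.2.1
  · intro t ht
    rw [← eb, mem_part_contours] at ht
    rw [ht.2.2 P hP]
    exact P.mem_part ht.2.1

/-- Two blocks without a common triangle, if they have property P.1. -/
theorem WellSeparated.disjoint {c : ℝ} (hc : 0 ≤ c) {Γ Γ' : Finset Triangle}
    (h : WellSeparated c Γ Γ') : Disjoint Γ Γ' := by
  rw [Finset.disjoint_left]
  intro T hT hT'
  have h2 := h.2 T hT T hT'
  have : (Triangle.dist T T : ℝ) = 0 := by simp [Triangle.dist]
  rw [this] at h2
  have : 0 ≤ c * (min (contourMass Γ) (contourMass Γ') : ℝ) ^ 3 := by positivity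
  linarith

/-- A contour map exists for every choice of roots, every volume and every constant. -/
theorem isContourMap_contours (r : ℤ → ℝ) (N : ℕ) {c : ℝ} (hc : 0 ≤ c) :
    IsContourMap r N c (contours c) := by
  refine ⟨fun F _ => isSeparated_contours hc F, ?_⟩
  intro k F _ _ hsep
  set U := Finset.univ.biUnion F with hU
  have hFU : ∀ i, F i ⊆ U := fun i => Finset.subset_biUnion_of_mem F (Finset.mem_univ i)
  have hdisj : ∀ i i', i ≠ i' → Disjoint (F i) (F i') := by
    intro i i' hi
    rw [Finset.disjoint_left]
    intro T h1 h2
    exact Finset.disjoint_left.1 (WellSeparated.disjoint hc (hsep i i' hi _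
      ((contours c (F i)).part_mem.2 h1) _ ((contours c (F i')).part_mem.2 h2)))
      ((contours c (F i)).mem_part h1) ((contours c (F i')).mem_part h2)
  -- the partition formed by all the contours of the single families
  let Q : Finpartition U := Finpartition.ofExistsUnique
    (Finset.univ.biUnion fun i => (contours c (F i)).parts)
    (by
      intro p hp
      simp only [Finset.mem_biUnion, Finset.mem_univ, true_and] at hp
      obtain ⟨i, hi⟩ := hp
      exact ((contours c (F i)).le hi).trans (hFU i))
    (by
      intro a ha
      simp only [hU, Finset.mem_biUnion, Finset.mem_univ, true_and] at ha
      obtain ⟨i, hi⟩ := ha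
      refine ⟨(contours c (F i)).part a, ⟨?_, (contours c (F i)).mem_part hi⟩, ?_⟩
      · simp only [Finset.mem_biUnion, Finset.mem_univ, true_and]
        exact ⟨i, (contours c (F i)).part_mem.2 hi⟩
      · rintro t ⟨ht, hat⟩
        simp only [Finset.mem_biUnion, Finset.mem_univ, true_and] at ht
        obtain ⟨j, hj⟩ := ht
        have hij : i = j := by
          by_contra hne
          exact Finset.disjoint_left.1 (hdisj i j hne) hi ((contours c (F j)).le hj hat)
        subst hij
        exact ((contours c (F i)).part_eq_of_mem hj hat).symm)
    (by
      simp only [Finset.mem_biUnion, Finset.mem_univ, true_and, not_exists]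
      exact fun i => (contours c (F i)).bot_notMem)
  have hQparts : ∀ p, p ∈ Q.parts ↔ ∃ i, p ∈ (contours c (F i)).parts := by
    intro p
    change p ∈ Finset.univ.biUnion _ ↔ _
    simp
  have hQ : IsSeparated c Q := by
    intro Γ hΓ Γ' hΓ' hne
    obtain ⟨i, hi⟩ := (hQparts Γ).1 hΓ
    obtain ⟨j, hj⟩ := (hQparts Γ').1 hΓ'
    by_cases hij : i = j
    · subst hij
      exact isSeparated_contours hc _ _ hi _ hj hne
    · exact hsep i j hij _ hi _ hj
  have hpart : ∀ i, ∀ a ∈ F i, (contours c U).part a = (contours c (F i)).part a := by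
    intro i a ha
    ext b
    rw [mem_part_contours, mem_part_contours]
    constructor
    · rintro ⟨_, hb, h⟩
      have hm : (contours c (F i)).part a ∈ Q.parts :=
        (hQparts _).2 ⟨i, (contours c (F i)).part_mem.2 ha⟩
      have hb' : b ∈ (contours c (F i)).part a := by
        rw [← Q.part_eq_of_mem hm ((contours c (F i)).mem_part ha), h Q hQ]
        exact Q.mem_part hb
      exact mem_part_contours.1 hb'
    · rintro ⟨_, hb, h⟩
      refine ⟨hFU i ha, hFU i hb, fun P hP => ?_⟩
      let R : Finpartition (F i) := Finpartition.ofExistsUnique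
        ((P.parts.image fun B => B ∩ F i).erase ∅)
        (by
          intro p hp
          simp only [Finset.mem_erase, Finset.mem_image] at hp
          obtain ⟨_, B, _, rfl⟩ := hp
          exact Finset.inter_subset_right)
        (by
          intro t ht
          refine ⟨P.part t ∩ F i, ⟨?_, ?_⟩, ?_⟩
          · simp only [Finset.mem_erase, Finset.mem_image]
            exact ⟨Finset.ne_empty_of_mem (Finset.mem_inter.2 ⟨P.mem_part (hFU i ht), ht⟩),
              _, P.part_mem.2 (hFU i ht), rfl⟩
          · exact Finset.mem_inter.2 ⟨P.mem_part (hFU i ht), ht⟩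
          · rintro p ⟨hp, htp⟩
            simp only [Finset.mem_erase, Finset.mem_image] at hp
            obtain ⟨_, B, hB, rfl⟩ := hp
            rw [P.part_eq_of_mem hB (Finset.mem_inter.1 htp).1])
        (by simp)
      have hRp : ∀ p ∈ R.parts, ∃ B ∈ P.parts, p = B ∩ F i := by
        intro p hp
        change p ∈ (P.parts.image fun B => B ∩ F i).erase ∅ at hp
        simp only [Finset.mem_erase, Finset.mem_image] at hp
        obtain ⟨_, B, hB, rfl⟩ := hp
        exact ⟨B, hB, rfl⟩
      have hR : IsSeparated c R := by
        intro Γ hΓ Γ' hΓ' hne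
        obtain ⟨B, hB, rfl⟩ := hRp Γ hΓ
        obtain ⟨B', hB', rfl⟩ := hRp Γ' hΓ'
        exact (hP B hB B' hB' (fun e => hne (by rw [e]))).mono hc
          Finset.inter_subset_left Finset.inter_subset_left
      have hab := h R hR
      obtain ⟨B, hB, hBe⟩ := hRp _ (R.part_mem.2 ha)
      have ha' : a ∈ B ∩ F i := hBe ▸ R.mem_part ha
      have hb' : b ∈ B ∩ F i := hBe ▸ hab ▸ R.mem_part hb
      rw [P.part_eq_of_mem hB (Finset.mem_inter.1 ha').1,
        P.part_eq_of_mem hB (Finset.mem_inter.1 hb').1]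
  ext Γ
  simp only [Finset.mem_biUnion, Finset.mem_univ, true_and]
  constructor
  · intro hΓ
    obtain ⟨a, ha⟩ := (contours c U).nonempty_of_mem_parts hΓ
    have haU := (contours c U).le hΓ ha
    obtain ⟨i, -, hi⟩ := Finset.mem_biUnion.1 haU
    refine ⟨i, ?_⟩
    rw [← (contours c U).part_eq_of_mem hΓ ha, hpart i a hi]
    exact (contours c (F i)).part_mem.2 hi
  · rintro ⟨i, hΓ⟩
    obtain ⟨a, ha⟩ := (contours c (F i)).nonempty_of_mem_parts hΓ
    have hi := (contours c (F i)).le hΓ ha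
    rw [← (contours c (F i)).part_eq_of_mem hΓ ha, ← hpart i a hi]
    exact (contours c U).part_mem.2 (hFU i hi)

theorem spin_eq_of_triangulates {r : ℤ → ℝ} {S : Finset ℤ} {F : Finset Triangle}
    (h : Triangulates r S F) (x : ℤ) :
    (∀ T ∈ F, T.left ∈ S) ∧ spin F x = (-1) ^ ({i ∈ S | i < x}).card := by
  induction h with
  | nil => simp [spin]
  | step S F T hl hr hmin hF ih =>
    obtain ⟨ih1, ih2⟩ := ih
    have hT : T ∉ F := fun h => by simpa using ih1 T h
    refine ⟨?_, ?_⟩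
    · intro T' hT'
      rcases Finset.mem_insert.1 hT' with rfl | h
      · exact hl
      · exact (Finset.mem_sdiff.1 (ih1 T' h)).1
    · have hS : S = insert T.left (insert T.right (S \ {T.left, T.right})) := by
        ext i
        simp only [Finset.mem_insert, Finset.mem_sdiff, Finset.mem_singleton]
        constructor
        · intro hi; tauto
        · rintro (rfl | rfl | h)
          exacts [hl, hr, h.1]
      have hlt := T.lt
      unfold spin at ih2 ⊢
      rw [hS, Finset.filter_insert, Finset.filter_insert, Finset.filter_insert]
      simp only [Triangle.base, Finset.mem_Ioc] at ih2 ⊢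
      by_cases h1 : T.left < x <;> by_cases h2 : T.right < x
      · rw [if_neg (by omega), if_pos h1, if_pos h2, Finset.card_insert_of_notMem,
          Finset.card_insert_of_notMem, ih2, pow_succ, pow_succ]
        · simp
        · simp
        · simp; omega
      · rw [if_pos (by omega), if_pos h1, if_neg h2, Finset.card_insert_of_notMem,
          Finset.card_insert_of_notMem, pow_succ, ih2, pow_succ]
        · simp
        · simp [hT]
      · omega
      · rw [if_neg (by omega), if_neg h1, if_neg h2, ih2]

/-- The spin configuration determined by the triangles of `σ` is `σ` itself. -/
theorem spin_eq {r : ℤ → ℝ} {N : ℕ} {σ : ℤ → ℤˣ} {F : Finset Triangle}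
    (hσ : IsPlusOutside N σ) (h : Triangulates r (flips N σ) F) : spin F = σ := by
  funext x
  rw [(spin_eq_of_triangulates h x).2]
  have hlow : ∀ x : ℤ, x ≤ -(N : ℤ) - 1 → (-1) ^ ({i ∈ flips N σ | i < x}).card = σ x := by
    intro x hx
    rw [hσ x (by simp; omega)]
    have : ({i ∈ flips N σ | i < x}) = ∅ := by
      ext i; simp [flips]; omega
    simp [this]
  rcases le_total x (-(N : ℤ) - 1) with hx | hx
  · exact hlow x hx
  · induction x, hx using Int.leInduction with
    | base => exact hlow _ le_rfl
    | succ n hn ih =>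
      have hset : ({i ∈ flips N σ | i < n + 1}) =
          if σ n ≠ σ (n + 1) then insert n ({i ∈ flips N σ | i < n})
          else ({i ∈ flips N σ | i < n}) := by
        by_cases hnN : n ≤ N
        · ext i
          split_ifs with hc <;> simp only [flips, Finset.mem_filter, Finset.mem_Icc,
            Finset.mem_insert]
          · constructor
            · rintro ⟨⟨h1, h2⟩, h3⟩
              by_cases hi : i = n
              · exact Or.inl hi
              · exact Or.inr ⟨⟨h1, h2⟩, by omega⟩
            · rintro (rfl | ⟨h1, h2⟩)
              · exact ⟨⟨⟨hn, hnN⟩, hc⟩, by omega⟩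
              · exact ⟨h1, by omega⟩
          · constructor
            · rintro ⟨⟨h1, h2⟩, h3⟩
              by_cases hi : i = n
              · subst hi; exact absurd h2 hc
              · exact ⟨⟨h1, h2⟩, by omega⟩
            · rintro ⟨h1, h2⟩
              exact ⟨h1, by omega⟩
        · have e1 := hσ n (by simp; omega)
          have e2 := hσ (n + 1) (by simp; omega)
          rw [if_neg (by simp [e1, e2])]
          ext i; simp [flips]; omega
      rw [hset]
      split_ifs with hc
      · rw [Finset.card_insert_of_notMem (by simp), pow_succ, ih]
        rcases Int.units_eq_one_or (σ n) with h1 | h1 <;>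
          rcases Int.units_eq_one_or (σ (n + 1)) with h2 | h2 <;> simp_all
      · rw [ih]; simpa using hc

/-- Admissible choices of roots exist. -/
theorem exists_isRootChoice : ∃ r : ℤ → ℝ, IsRootChoice r := by
  set δ : ℤ → ℝ := fun i => (1 / 4 : ℝ) ^ (Encodable.encode i) with hδ
  have pos : ∀ i, 0 < δ i := fun i => by positivity
  have le1 : ∀ i, δ i ≤ 1 := fun i => pow_le_one₀ (by norm_num) (by norm_num)
  have cmp : ∀ i j, i ≠ j → 4 * δ i ≤ δ j ∨ 4 * δ j ≤ δ i := by
    intro i j hij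
    have hne : Encodable.encode i ≠ Encodable.encode j :=
      fun h => hij (Encodable.encode_injective h)
    have aux : ∀ m n : ℕ, m < n → 4 * (1 / 4 : ℝ) ^ n ≤ (1 / 4) ^ m := by
      intro m n h
      have := pow_le_pow_of_le_one (a := (1 / 4 : ℝ)) (by norm_num) (by norm_num) h
      rw [Nat.succ_eq_add_one, pow_succ] at this
      linarith
    rcases lt_or_gt_of_ne hne with h | h
    · exact Or.inr (aux _ _ h)
    · exact Or.inl (aux _ _ h)
  refine ⟨fun i => i + 1 / 2 + 1 / 100 * δ i, ⟨fun i => ?_, ?_⟩⟩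
  · have := pos i; have := le1 i
    constructor <;> linarith
  · intro a b c d hn h
    simp only [List.nodup_cons, List.mem_cons, not_or, List.not_mem_nil, not_false_eq_true] at hn
    have pa := pos a; have pb := pos b; have pc := pos c; have pd := pos d
    have la := le1 a; have lb := le1 b; have lc := le1 c; have ld := le1 d
    have ab := cmp a b (by tauto); have ac := cmp a c (by tauto); have ad := cmp a d (by tauto)
    have bc := cmp b c (by tauto); have bd := cmp b d (by tauto); have cd := cmp c d (by tauto)
    have key : ∀ m : ℤ, ∀ e : ℝ, (m : ℝ) + 1 / 100 * e = 0 → |e| ≤ 4 → e = 0 := by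
      intro m e h1 h2
      have h3 := abs_le.1 h2
      have : m = 0 := by
        have u : (m : ℝ) < 1 := by linarith
        have l : (-1 : ℝ) < m := by linarith
        have u' : m < 1 := by exact_mod_cast u
        have l' : -1 < m := by exact_mod_cast l
        omega
      subst this
      simpa using h1
    have sgn : ∀ s : ℝ, s = 1 ∨ s = -1 → δ a - δ b - s * (δ c - δ d) ≠ 0 := by
      intro s hs h0
      rcases ab with ab | ab <;> rcases cd with cd | cd
      · rcases bd with bd | bd <;> rcases hs with rfl | rfl <;> linarith
      · rcases bc with bc | bc <;> rcases hs with rfl | rfl <;> linarith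
      · rcases ad with ad | ad <;> rcases hs with rfl | rfl <;> linarith
      · rcases ac with ac | ac <;> rcases hs with rfl | rfl <;> linarith
    rcases abs_eq_abs.1 h with h | h
    · refine sgn 1 (Or.inl rfl) (key (a - b - c + d) _ ?_ (abs_le.2 ⟨?_, ?_⟩))
      · push_cast; linarith
      all_goals linarith
    · refine sgn (-1) (Or.inr rfl) (key (a - b + c - d) _ ?_ (abs_le.2 ⟨?_, ?_⟩))
      · push_cast; linarith
      all_goals linarith

end

end LongRangeIsing

open LongRangeIsing

/-!
The lower bounds hold for every `α' ≤ α`, and the witness is `α' = 0`.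

**The function `W₀`.** With `R(n) = ∑_{k ≥ n} k⁻²` and `S(L) = R(1) + ⋯ + R(L)` one has
`W₀(L) / 2 = 3 S(L) - 2 S(2 L)`. As `1 / n ≤ R(n) ≤ 1 / (n - 1/2)`, the increments of `W₀` are of
order `1 / L` and `W₀(1)` is positive, so that `W₀(L)` grows at least like `χ₀(L)`; this is
`exists_isLowerConstant_zero`.

**The energy of one contour.** Two triangles of a compatible family have a distance of at least the
smaller of their masses (`Triangulates.min_mass_le_dist`), and this property passes to subfamilies.
The smallest triangle `T` of such a family lies in an interval on which the configuration of the
others is constant up to distance `|T|` from `Δ(T)`, so that removing it lowers the energy by at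
least `W_{α'}(|T|)`. Removing the triangles one after the other gives the energy bound for `α'`
(`sum_W_le_energy`). Since the coupling increases with `α`, it also holds for `α`.

**The interaction with the other contours.** Let `ρ` be the configuration of `Γ` and `τ` that of the
other contours. The conditional energy of `Γ` is its energy minus the total coupling, over ordered
pairs, of the pairs of sites on which both `ρ` and `τ` disagree (`energy_mul`). It suffices that this
overlap is at most half the energy of `Γ` if `c` is large. A pair of this kind is separated by a
triangle of some other contour `Γ'`.

* If `|Γ'| ≥ |Γ|`, the two sites are at a distance of more than `c |Γ|³`, hence more than `c M`,
  where `M` is the number of minus sites of `Γ`. The coupling of a minus site to all sites that far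
  away is at most a constant times `(c M) ^ (α - 1)`, whereas its coupling to the plus sites is at
  least `M ^ (α - 1)`, as the minus sites cannot fill a ball of radius `M`
  (`tsum_pairs_far_le`).
* If `|Γ'| = m < |Γ|`, one of the two sites lies in the base of `Γ'`. In the ball of radius of order
  `c m³` about this site `ρ` is constant, and the coupling of a site to the sites of opposite sign
  varies there by a bounded factor. It can be averaged over the ball, and the balls belonging to
  different contours of the same mass are disjoint. So the contours of mass `m` contribute at most
  the fraction `m / (c m³)` of the energy of `Γ`, up to a constant, and `∑ m⁻²` converges
  (`sum_sum_le_of_balls_disjoint`).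
-/

namespace LongRangeIsing

/-! ### The coupling and its tails -/

theorem coupling_nonneg (α : ℝ) (n : ℕ) : 0 ≤ coupling α n := by
  unfold coupling; positivity

/-- By the convention `0 ^ s = 0` for `s ≠ 0`, a site does not interact with itself. -/
theorem coupling_zero {α : ℝ} (hα : α < 1) : coupling α 0 = 0 := by
  unfold coupling
  rw [Nat.cast_zero, Real.zero_rpow (by linarith)]

theorem coupling_anti {α : ℝ} (hα : α < 1) {m n : ℕ} (hm : 1 ≤ m) (hmn : m ≤ n) :
    coupling α n ≤ coupling α m :=
  Real.rpow_le_rpow_of_nonpos (by exact_mod_cast hm) (by exact_mod_cast hmn) (by linarith)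

theorem coupling_mono {α' α : ℝ} (h : α' ≤ α) {n : ℕ} (hn : 1 ≤ n) :
    coupling α' n ≤ coupling α n :=
  Real.rpow_le_rpow_of_exponent_le (by exact_mod_cast hn) (by linarith)

theorem summable_coupling {α : ℝ} (hα : α < 1) : Summable (coupling α) :=
  Real.summable_nat_rpow.2 (by linarith)

/-- The tail `∑_{k ≥ n} J(k)` of the coupling. -/
noncomputable def couplingTail (α : ℝ) (n : ℕ) : ℝ := ∑' k : ℕ, coupling α (k + n)

theorem summable_coupling_add {α : ℝ} (hα : α < 1) (n : ℕ) :
    Summable fun k : ℕ => coupling α (k + n) :=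
  (summable_nat_add_iff n).2 (summable_coupling hα)

theorem couplingTail_eq {α : ℝ} (hα : α < 1) (n : ℕ) :
    couplingTail α n = coupling α n + couplingTail α (n + 1) := by
  unfold couplingTail
  rw [(summable_coupling_add hα n).tsum_eq_zero_add, Nat.zero_add]
  congr 2
  ext k
  congr 1
  omega

/-- A series of nonnegative terms is at most the starting value of a nonnegative sequence
whose decrements dominate the terms. -/
theorem tsum_le_of_le_sub {f g : ℕ → ℝ} (hf : ∀ k, 0 ≤ f k) (hg : ∀ k, 0 ≤ g k)
    (h : ∀ k, f k ≤ g k - g (k + 1)) : ∑' k, f k ≤ g 0 := by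
  refine Real.tsum_le_of_sum_range_le hf fun n => ?_
  have h1 : ∑ k ∈ Finset.range n, f k ≤ ∑ k ∈ Finset.range n, (g k - g (k + 1)) :=
    Finset.sum_le_sum fun k _ => h k
  rw [Finset.sum_range_sub'] at h1
  linarith [hg n]

/-- A summable series is at least the starting value of a null sequence whose decrements are
dominated by the terms. -/
theorem le_tsum_of_sub_le {f g : ℕ → ℝ} (hf : Summable f)
    (hg : Filter.Tendsto g Filter.atTop (nhds 0))
    (h : ∀ k, g k - g (k + 1) ≤ f k) : g 0 ≤ ∑' k, f k := by
  have h1 : Filter.Tendsto (fun n => g 0 - g n) Filter.atTop (nhds (g 0 - 0)) :=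
    tendsto_const_nhds.sub hg
  rw [sub_zero] at h1
  refine le_of_tendsto_of_tendsto' h1 hf.hasSum.tendsto_sum_nat fun n => ?_
  rw [← Finset.sum_range_sub']
  exact Finset.sum_le_sum fun k _ => h k

/-- `∑_{k > K} J(k) ≤ K ^ (α - 1) / (1 - α)`, by comparison with the decrements of
`k ^ (α - 1) / (1 - α)`. -/
theorem couplingTail_succ_le {α : ℝ} (h0 : 0 ≤ α) (h1 : α < 1) {K : ℕ} (hK : 1 ≤ K) :
    couplingTail α (K + 1) ≤ (K : ℝ) ^ (α - 1) / (1 - α) := by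
  have hb : 0 < 1 - α := by linarith
  have key := tsum_le_of_le_sub (f := fun k : ℕ => coupling α (k + (K + 1)))
    (g := fun k : ℕ => ((k + K : ℕ) : ℝ) ^ (α - 1) / (1 - α))
    (fun k => coupling_nonneg _ _) (fun k => by positivity) ?_
  · simpa [couplingTail] using key
  intro k
  have hx : (1 : ℝ) ≤ ((k + K : ℕ) : ℝ) := by exact_mod_cast (by omega : 1 ≤ k + K)
  set x : ℝ := ((k + K : ℕ) : ℝ) with hxd
  have e1 : ((k + 1 + K : ℕ) : ℝ) = x + 1 := by rw [hxd]; push_cast; ring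
  have e2 : ((k + (K + 1) : ℕ) : ℝ) = x + 1 := by rw [hxd]; push_cast; ring
  simp only [coupling]
  rw [e1, e2, ← sub_div, le_div_iff₀ hb]
  have hy : 0 < x + 1 := by linarith
  have hx0 : 0 < x := by linarith
  -- Bernoulli's inequality for `x = (x + 1) (1 - 1 / (x + 1))`
  have hB : (x / (x + 1)) ^ (1 - α) ≤ 1 - (1 - α) / (x + 1) := by
    have := rpow_one_add_le_one_add_mul_self (s := -(1 / (x + 1))) (p := 1 - α)
      (by rw [neg_le_neg_iff, div_le_one hy]; linarith) hb.le (by linarith)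
    have e : 1 + -(1 / (x + 1)) = x / (x + 1) := by field_simp; ring
    rw [e] at this
    refine this.trans (le_of_eq ?_)
    ring
  have hA : 0 < (x / (x + 1)) ^ (1 - α) := Real.rpow_pos_of_pos (by positivity) _
  have e3 : (x + 1) ^ (-2 + α) = (x + 1) ^ (α - 1) / (x + 1) := by
    rw [show -2 + α = (α - 1) - 1 by ring, Real.rpow_sub_one hy.ne']
  have e4 : x ^ (α - 1) * (x / (x + 1)) ^ (1 - α) = (x + 1) ^ (α - 1) := by
    rw [Real.div_rpow hx0.le hy.le, show α - 1 = -(1 - α) by ring, Real.rpow_neg hx0.le,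
      Real.rpow_neg hy.le]
    have := Real.rpow_pos_of_pos hx0 (1 - α)
    field_simp
  rw [e3]
  have hP : 0 < x ^ (α - 1) := Real.rpow_pos_of_pos hx0 _
  have hQ : 0 < (x + 1) ^ (α - 1) := Real.rpow_pos_of_pos hy _
  set t := (1 - α) / (x + 1) with ht
  have ht0 : 0 < t := by positivity
  have hle : (x + 1) ^ (α - 1) * (1 + t) ≤ x ^ (α - 1) := by
    rw [← e4, mul_assoc]
    have : (x / (x + 1)) ^ (1 - α) * (1 + t) ≤ (1 - t) * (1 + t) :=
      mul_le_mul_of_nonneg_right hB (by linarith)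
    nlinarith [sq_nonneg t]
  have : (x + 1) ^ (α - 1) / (x + 1) * (1 - α) = (x + 1) ^ (α - 1) * t := by
    rw [ht]; ring
  rw [this]
  linarith

theorem coupling_zero_left (n : ℕ) : coupling 0 n = 1 / (n : ℝ) ^ 2 := by
  unfold coupling
  rw [add_zero, Real.rpow_neg (Nat.cast_nonneg n), one_div]
  norm_num

theorem one_div_le_couplingTail {n : ℕ} (hn : 1 ≤ n) : 1 / (n : ℝ) ≤ couplingTail 0 n := by
  have key := le_tsum_of_sub_le (g := fun k : ℕ => 1 / ((k : ℝ) + n))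
    (summable_coupling_add (α := 0) one_pos n) ?_ ?_
  · simpa [couplingTail] using key
  · have h := (tendsto_one_div_add_atTop_nhds_zero_nat (𝕜 := ℝ)).comp
      (Filter.tendsto_add_atTop_nat (n - 1))
    refine h.congr fun k => ?_
    simp only [Function.comp]
    push_cast [Nat.cast_sub hn]
    ring
  · intro k
    have hx : (1 : ℝ) ≤ n := by exact_mod_cast hn
    have hk : (0 : ℝ) ≤ k := Nat.cast_nonneg k
    rw [coupling_zero_left, div_sub_div _ _ (by positivity) (by positivity),
      div_le_div_iff₀ (by positivity) (by positivity)]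
    push_cast
    nlinarith

theorem couplingTail_le {n : ℕ} (hn : 1 ≤ n) : couplingTail 0 n ≤ 1 / ((n : ℝ) - 1 / 2) := by
  have hx : (1 : ℝ) ≤ n := by exact_mod_cast hn
  have key := tsum_le_of_le_sub (f := fun k : ℕ => coupling 0 (k + n))
    (g := fun k : ℕ => 1 / ((k : ℝ) + n - 1 / 2))
    (fun k => coupling_nonneg _ _) ?_ ?_
  · simpa [couplingTail] using key
  · intro k
    have hk : (0 : ℝ) ≤ k := Nat.cast_nonneg k
    exact div_nonneg zero_le_one (by linarith)
  · intro k
    have hk : (0 : ℝ) ≤ k := Nat.cast_nonneg k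
    have h1 : (0 : ℝ) < k + n - 1 / 2 := by linarith
    rw [coupling_zero_left, div_sub_div _ _ (by positivity) (by push_cast; linarith),
      div_le_div_iff₀ (by positivity) (by push_cast; nlinarith)]
    push_cast
    nlinarith

/-! ### The lower bound for `W₀` -/

theorem hasSum_coupling_Ici {α : ℝ} (hα : α < 1) (x : ℤ) (n : ℕ) :
    HasSum (fun y : {y : ℤ | x + n ≤ y} => coupling α (x - y).natAbs) (couplingTail α n) := by
  have hinj : Function.Injective fun k : ℕ => x + n + (k : ℤ) := fun a b h => by
    simpa using h
  have hr : {y : ℤ | x + n ≤ y} = Set.range fun k : ℕ => x + n + (k : ℤ) := by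
    ext y
    simp only [Set.mem_ofPred_eq, Set.mem_range]
    exact ⟨fun h => ⟨(y - (x + n)).toNat, by omega⟩, by rintro ⟨k, rfl⟩; omega⟩
  rw [hr]
  refine (hinj.hasSum_range_iff (f := fun y : ℤ => coupling α (x - y).natAbs)).2 ?_
  refine (summable_coupling_add hα n).hasSum.congr_fun fun k => ?_
  simp only [Function.comp]
  congr 1
  omega

theorem hasSum_coupling_Iic {α : ℝ} (hα : α < 1) (x : ℤ) (n : ℕ) :
    HasSum (fun y : {y : ℤ | y ≤ x - n} => coupling α (x - y).natAbs) (couplingTail α n) := by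
  have hinj : Function.Injective fun k : ℕ => x - n - (k : ℤ) := fun a b h => by
    simpa using h
  have hr : {y : ℤ | y ≤ x - n} = Set.range fun k : ℕ => x - n - (k : ℤ) := by
    ext y
    simp only [Set.mem_ofPred_eq, Set.mem_range]
    exact ⟨fun h => ⟨(x - n - y).toNat, by omega⟩, by rintro ⟨k, rfl⟩; omega⟩
  rw [hr]
  refine (hinj.hasSum_range_iff (f := fun y : ℤ => coupling α (x - y).natAbs)).2 ?_
  refine (summable_coupling_add hα n).hasSum.congr_fun fun k => ?_
  simp only [Function.comp]
  congr 1
  omega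

/-- The interaction of a site with everything at distance at least `n` on its left and at least
`m` on its right. -/
theorem hasSum_coupling_two_sided {α : ℝ} (hα : α < 1) (x : ℤ) {m n : ℕ} (h : 1 ≤ m + n) :
    HasSum (fun y : {y : ℤ // x + m ≤ y ∨ y ≤ x - n} => coupling α (x - y.1).natAbs)
      (couplingTail α m + couplingTail α n) := by
  refine HasSum.add_disjoint (f := fun y : ℤ => coupling α (x - y).natAbs)
    (s := {y : ℤ | x + m ≤ y}) (t := {y : ℤ | y ≤ x - n}) ?_
    (hasSum_coupling_Ici hα x m) (hasSum_coupling_Iic hα x n)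
  rw [Set.disjoint_left]
  intro y h1 h2
  simp only [Set.mem_ofPred_eq] at h1 h2
  omega

theorem sum_coupling_eq_sub {α : ℝ} (hα : α < 1) (n L : ℕ) :
    ∑ k ∈ Finset.range L, coupling α (k + n) = couplingTail α n - couplingTail α (n + L) := by
  have := (summable_coupling_add hα n).sum_add_tsum_nat_add L
  unfold couplingTail
  rw [← this]
  have e : (fun k => coupling α (k + (n + L))) = fun k => coupling α (k + L + n) := by
    ext k; congr 1; omega
  rw [e]
  ring

/-- `W_α` in terms of the tails of the coupling. -/
theorem W_eq_sum_tails {α : ℝ} (hα : α < 1) (L : ℕ) :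
    W α L = 2 * ∑ k ∈ Finset.range L, (couplingTail α (k + 1) - 2 * couplingTail α (k + 1 + L)) := by
  -- the site at distance `k + 1` from the left end
  have hsite : ∀ k ∈ Finset.range L,
      ((∑ y ∈ Finset.Icc ((L : ℤ) + 1) (2 * L) ∪ Finset.Icc (-(L : ℤ) + 1) 0,
        coupling α ((k + 1 : ℤ) - y).natAbs)
      - ∑' y : {y : ℤ // 2 * (L : ℤ) + 1 ≤ y ∨ y ≤ -(L : ℤ)},
          coupling α ((k + 1 : ℤ) - y.1).natAbs)
      = (couplingTail α (L - 1 - k + 1) - 2 * couplingTail α (L - 1 - k + 1 + L))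
        + (couplingTail α (k + 1) - 2 * couplingTail α (k + 1 + L)) := by
    intro k hk
    rw [Finset.mem_range] at hk
    have hfar := (hasSum_coupling_two_sided hα (k + 1 : ℤ) (m := L - 1 - k + 1 + L)
      (n := k + 1 + L) (by omega)).tsum_eq
    have e1 : (k + 1 : ℤ) + ((L - 1 - k + 1 + L : ℕ) : ℤ) = 2 * L + 1 := by omega
    have e2 : (k + 1 : ℤ) - ((k + 1 + L : ℕ) : ℤ) = -L := by omega
    rw [e1, e2] at hfar
    rw [hfar, Finset.sum_union]
    · have hR : ∑ y ∈ Finset.Icc ((L : ℤ) + 1) (2 * L), coupling α ((k + 1 : ℤ) - y).natAbs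
          = couplingTail α (L - 1 - k + 1) - couplingTail α (L - 1 - k + 1 + L) := by
        rw [← sum_coupling_eq_sub hα]
        symm
        refine Finset.sum_bij (fun i _ => (L : ℤ) + 1 + i) ?_ ?_ ?_ ?_
        · intro i hi; simp only [Finset.mem_range, Finset.mem_Icc] at *; omega
        · intro i _ j _ h; simpa using h
        · intro y hy
          simp only [Finset.mem_Icc] at hy
          exact ⟨(y - (L + 1)).toNat, by simp only [Finset.mem_range]; omega, by omega⟩
        · intro i _; congr 1; omega
      have hL : ∑ y ∈ Finset.Icc (-(L : ℤ) + 1) 0, coupling α ((k + 1 : ℤ) - y).natAbs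
          = couplingTail α (k + 1) - couplingTail α (k + 1 + L) := by
        rw [← sum_coupling_eq_sub hα]
        symm
        refine Finset.sum_bij (fun i _ => -(i : ℤ)) ?_ ?_ ?_ ?_
        · intro i hi; simp only [Finset.mem_range, Finset.mem_Icc] at *; omega
        · intro i _ j _ h; simpa using h
        · intro y hy
          simp only [Finset.mem_Icc] at hy
          exact ⟨(-y).toNat, by simp only [Finset.mem_range]; omega, by omega⟩
        · intro i _; congr 1; omega
      rw [hR, hL]
      ring
    · rw [Finset.disjoint_left]
      intro y h1 h2
      simp only [Finset.mem_Icc] at h1 h2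
      omega
  unfold W
  have hre : ∀ f : ℤ → ℝ, ∑ x ∈ Finset.Icc (1 : ℤ) L, f x
      = ∑ k ∈ Finset.range L, f ((k : ℤ) + 1) := by
    intro f
    symm
    refine Finset.sum_bij (fun i _ => (i : ℤ) + 1) ?_ ?_ ?_ ?_
    · intro i hi; simp only [Finset.mem_range, Finset.mem_Icc] at *; omega
    · intro i _ j _ h; simpa using h
    · intro y hy
      simp only [Finset.mem_Icc] at hy
      exact ⟨(y - 1).toNat, by simp only [Finset.mem_range]; omega, by omega⟩
    · intro i _; rfl
  rw [hre, Finset.sum_congr rfl hsite, Finset.sum_add_distrib,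
    Finset.sum_range_reflect
      (fun k => couplingTail α (k + 1) - 2 * couplingTail α (k + 1 + L)) L, two_mul]

/-- The increment of `W`: since `W_α(L) / 2 = 3 S(L) - 2 S(2 L)` for the partial sums `S` of the
tails of the coupling. -/
theorem W_succ {α : ℝ} (hα : α < 1) (L : ℕ) :
    W α (L + 1) = W α L + 2 * (3 * couplingTail α (L + 1) - 2 * couplingTail α (2 * L + 1)
      - 2 * couplingTail α (2 * L + 2)) := by
  have h : ∀ n : ℕ, W α n = 2 * (3 * ∑ k ∈ Finset.range n, couplingTail α (k + 1)
      - 2 * ∑ k ∈ Finset.range (2 * n), couplingTail α (k + 1)) := by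
    intro n
    rw [W_eq_sum_tails hα, Finset.sum_sub_distrib, ← Finset.mul_sum, two_mul n,
      Finset.sum_range_add]
    have : ∑ k ∈ Finset.range n, couplingTail α (k + 1 + n)
        = ∑ k ∈ Finset.range n, couplingTail α (n + k + 1) :=
      Finset.sum_congr rfl fun k _ => by congr 1; omega
    rw [this]
    ring
  rw [h, h, show 2 * (L + 1) = 2 * L + 1 + 1 by ring, Finset.sum_range_succ,
    Finset.sum_range_succ _ (2 * L + 1), Finset.sum_range_succ _ (2 * L)]
  ring

theorem W_zero_ge {L : ℕ} (hL : 1 ≤ L) : 2 / 3 + Real.log L / 10 ≤ W 0 L := by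
  induction L, hL using Nat.le_induction with
  | base =>
    have h0 : W 0 0 = 0 := by simp [W]
    have h := W_succ (α := 0) one_pos 0
    simp only [Nat.zero_add, Nat.mul_zero] at h
    have h1 := couplingTail_eq (α := 0) one_pos 1
    have h2 : couplingTail 0 2 ≤ _ := couplingTail_le (n := 2) (by norm_num)
    norm_num [coupling_zero_left] at h1 h2
    rw [h, h0]
    norm_num
    linarith
  | succ L hL ih =>
    have hx : (1 : ℝ) ≤ L := by exact_mod_cast hL
    have h1 := one_div_le_couplingTail (n := L + 1) (by omega)
    have h2 := couplingTail_le (n := 2 * L + 1) (by omega)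
    have h3 := couplingTail_le (n := 2 * L + 2) (by omega)
    push_cast at h1 h2 h3 ⊢
    have hlog : Real.log ((L : ℝ) + 1) ≤ Real.log L + 1 / L := by
      have e : (L : ℝ) + 1 = L * (1 + 1 / L) := by field_simp
      rw [e, Real.log_mul (by positivity) (by positivity)]
      have := Real.log_le_sub_one_of_pos (x := 1 + 1 / (L : ℝ)) (by positivity)
      linarith
    have key : 1 / (L : ℝ) / 10 ≤ 2 * (3 * (1 / ((L : ℝ) + 1)) - 2 * (1 / (2 * (L : ℝ) + 1 - 1 / 2))
        - 2 * (1 / (2 * (L : ℝ) + 2 - 1 / 2))) := by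
      -- in terms of `y = L - 1` all coefficients of the resulting numerator are positive
      obtain ⟨y, hy⟩ : ∃ y : ℝ, (L : ℝ) = 1 + y := ⟨L - 1, by ring⟩
      have hy0 : 0 ≤ y := by linarith
      rw [hy, ← sub_nonneg]
      have : 2 * (3 * (1 / (1 + y + 1)) - 2 * (1 / (2 * (1 + y) + 1 - 1 / 2))
        - 2 * (1 / (2 * (1 + y) + 2 - 1 / 2))) - 1 / (1 + y) / 10
        = (20 * (1 + y) * (3 * (4 * y + 5) * (4 * y + 7) - 4 * (y + 2) * (8 * y + 12))
          - (y + 2) * (4 * y + 5) * (4 * y + 7))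
          / (10 * (1 + y) * (y + 2) * (4 * y + 5) * (4 * y + 7)) := by
        have a1 : 2 * (1 + y) + 1 - 1 / 2 ≠ 0 := by linarith
        have a2 : 2 * (1 + y) + 2 - 1 / 2 ≠ 0 := by linarith
        have e1 : 2 * (1 + y) + 1 - 1 / 2 = (4 * y + 5) / 2 := by ring
        have e2 : 2 * (1 + y) + 2 - 1 / 2 = (4 * y + 7) / 2 := by ring
        have e3 : 1 + y + 1 = y + 2 := by ring
        rw [e1, e2, e3]
        field_simp
        ring
      rw [this]
      apply div_nonneg _ (by positivity)
      nlinarith [pow_nonneg hy0 2, pow_nonneg hy0 3]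
    have hW := W_succ (α := 0) one_pos L
    linarith

theorem exists_isLowerConstant_zero : ∃ ζ : ℝ, IsLowerConstant 0 ζ := by
  refine ⟨1 / 10, by norm_num, fun L hL => ?_⟩
  have := W_zero_ge hL
  simp only [chi, if_true]
  linarith

/-! ### Energies of spin configurations -/

/-- The zero-field energy of a spin configuration. -/
noncomputable def energy (α : ℝ) (σ : ℤ → ℤˣ) : ℝ :=
  1 / 2 * ∑' p : ℤ × ℤ, if σ p.1 ≠ σ p.2 then coupling α (p.1 - p.2).natAbs else 0

/-- The total coupling of the ordered pairs of sites on which both `τ` and `ρ` disagree. It measures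
by how much the energy fails to be additive under multiplication of configurations. -/
noncomputable def overlap (α : ℝ) (τ ρ : ℤ → ℤˣ) : ℝ :=
  ∑' p : ℤ × ℤ, if ρ p.1 ≠ ρ p.2 ∧ τ p.1 ≠ τ p.2 then coupling α (p.1 - p.2).natAbs else 0

/-- The coupling of the site `z` to the sites where `ρ` has the opposite sign. -/
noncomputable def siteEnergy (α : ℝ) (ρ : ℤ → ℤˣ) (z : ℤ) : ℝ :=
  ∑' w : ℤ, if ρ z ≠ ρ w then coupling α (z - w).natAbs else 0

theorem hamiltonian_eq_energy (α : ℝ) (C : Finset (Finset Triangle)) :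
    hamiltonian α C = energy α (spin (C.biUnion id)) := by
  unfold hamiltonian energy
  congr 2
  ext p
  congr 1
  refine propext ⟨And.right, fun h => ⟨fun e => h (by rw [e]), h⟩⟩

theorem energy_nonneg (α : ℝ) (σ : ℤ → ℤˣ) : 0 ≤ energy α σ :=
  mul_nonneg (by norm_num) (tsum_nonneg fun p => by
    split_ifs
    exacts [coupling_nonneg _ _, le_rfl])

theorem siteEnergy_nonneg (α : ℝ) (ρ : ℤ → ℤˣ) (z : ℤ) : 0 ≤ siteEnergy α ρ z :=
  tsum_nonneg fun w => by
    split_ifs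
    exacts [coupling_nonneg _ _, le_rfl]

theorem summable_coupling_sub {α : ℝ} (hα : α < 1) (z : ℤ) :
    Summable fun w : ℤ => coupling α (z - w).natAbs := by
  have h : Summable fun n : ℤ => coupling α n.natAbs :=
    Summable.of_nat_of_neg (by simpa using summable_coupling hα)
      (by simpa using summable_coupling hα)
  exact (Equiv.subLeft z).summable_iff.2 h

theorem summable_pairs {α : ℝ} (hα : α < 1) {ρ : ℤ → ℤˣ} {A : Finset ℤ}
    (hA : ∀ x, x ∉ A → ρ x = 1) :
    Summable fun p : ℤ × ℤ => if ρ p.1 ≠ ρ p.2 then coupling α (p.1 - p.2).natAbs else 0 := by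
  have h1 : Summable fun p : ℤ × ℤ => if p.1 ∈ A then coupling α (p.1 - p.2).natAbs else 0 := by
    refine (summable_prod_of_nonneg fun p => ?_).2 ⟨fun x => ?_, ?_⟩
    · dsimp only
      split_ifs
      exacts [coupling_nonneg _ _, le_rfl]
    · by_cases hx : x ∈ A
      · simpa [hx] using summable_coupling_sub hα x
      · simp [hx, summable_zero]
    · refine summable_of_ne_finset_zero (s := A) fun x hx => ?_
      simp [hx]
  have h2 := (Equiv.prodComm ℤ ℤ).summable_iff.2 h1
  refine Summable.of_nonneg_of_le (fun p => ?_) (fun p => ?_) (h1.add h2)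
  · split_ifs
    exacts [coupling_nonneg _ _, le_rfl]
  · have h0 := coupling_nonneg α (p.1 - p.2).natAbs
    have hsymm : (p.2 - p.1).natAbs = (p.1 - p.2).natAbs := by omega
    simp only [Function.comp, Equiv.prodComm_apply, Prod.fst_swap, Prod.snd_swap, hsymm]
    by_cases c1 : p.1 ∈ A <;> by_cases c2 : p.2 ∈ A
    · simp only [c1, c2, if_true]; split_ifs <;> linarith
    · simp only [c1, c2, if_true, if_false]; split_ifs <;> linarith
    · simp only [c1, c2, if_true, if_false]; split_ifs <;> linarith
    · rw [hA _ c1, hA _ c2]; simp [c1, c2]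

/-- A symmetric sum over the pairs with exactly one site in a finite set. -/
theorem tsum_pairs_eq {g : ℤ × ℤ → ℝ} (hs : Summable g) (hsymm : ∀ x y, g (x, y) = g (y, x))
    {A : Finset ℤ} (hA : ∀ x y, g (x, y) ≠ 0 → (x ∈ A ↔ y ∉ A)) :
    ∑' p, g p = 2 * ∑ x ∈ A, ∑' y, g (x, y) := by
  have hs1 : Summable fun p : ℤ × ℤ => if p.1 ∈ A then g p else 0 := by
    have := hs.indicator {p : ℤ × ℤ | p.1 ∈ A}
    exact this.congr fun p => by simp [Set.indicator]
  have hs2 := (Equiv.prodComm ℤ ℤ).summable_iff.2 hs1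
  have e : g = fun p => (if p.1 ∈ A then g p else 0)
      + ((fun p : ℤ × ℤ => if p.1 ∈ A then g p else 0) ∘ (Equiv.prodComm ℤ ℤ)) p := by
    funext ⟨x, y⟩
    simp only [Function.comp, Equiv.prodComm_apply, Prod.swap_prod_mk]
    rw [hsymm y x]
    by_cases h : g (x, y) = 0
    · simp [h]
    · have := hA x y h
      by_cases hx : x ∈ A
      · simp [hx, this.1 hx]
      · have hy : y ∈ A := by tauto
        simp [hx, hy]
  rw [e, hs1.tsum_add hs2, ← e]
  have e2 := (Equiv.prodComm ℤ ℤ).tsum_eq fun p : ℤ × ℤ => if p.1 ∈ A then g p else 0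
  simp only [Function.comp_def]
  rw [e2, ← two_mul, hs1.tsum_prod, tsum_eq_sum (s := A)]
  · congr 1
    refine Finset.sum_congr rfl fun x hx => ?_
    simp [hx]
  · intro x hx
    simp [hx]

theorem energy_eq_sum_siteEnergy {α : ℝ} (hα : α < 1) {ρ : ℤ → ℤˣ} {A : Finset ℤ}
    (hA : ∀ x, x ∈ A ↔ ρ x ≠ 1) : energy α ρ = ∑ z ∈ A, siteEnergy α ρ z := by
  unfold energy siteEnergy
  rw [tsum_pairs_eq (A := A) (summable_pairs (A := A) hα fun x hx => by simpa [hA] using hx)]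
  · ring
  · intro x y
    simp only [show (y - x).natAbs = (x - y).natAbs by omega, ne_comm]
  · intro x y h
    have hxy : ρ x ≠ ρ y := by
      by_contra h'
      simp [h'] at h
    rw [hA, hA]
    rcases Int.units_eq_one_or (ρ x) with h1 | h1 <;>
      rcases Int.units_eq_one_or (ρ y) with h2 | h2 <;> simp_all

theorem hasSum_siteEnergy {α : ℝ} (hα : α < 1) {ρ : ℤ → ℤˣ} {A : Finset ℤ}
    (hA : ∀ x, x ∉ A → ρ x = 1) : HasSum (siteEnergy α ρ) (2 * energy α ρ) := by
  have h := summable_pairs hα hA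
  have e : 2 * energy α ρ = ∑' z, siteEnergy α ρ z := by
    unfold energy siteEnergy
    rw [h.tsum_prod]
    ring
  rw [e]
  exact h.prod.hasSum

theorem energy_mono {α' α : ℝ} (h : α' ≤ α) (hα : α < 1) {ρ : ℤ → ℤˣ} {A : Finset ℤ}
    (hA : ∀ x, x ∉ A → ρ x = 1) : energy α' ρ ≤ energy α ρ := by
  unfold energy
  refine mul_le_mul_of_nonneg_left ?_ (by norm_num)
  refine Summable.tsum_le_tsum (fun p => ?_) (summable_pairs (h.trans_lt hα) hA)
    (summable_pairs hα hA)
  split_ifs with hp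
  · refine coupling_mono h ?_
    have : p.1 ≠ p.2 := fun e => hp (by rw [e])
    omega
  · exact le_rfl

theorem summable_overlap {α : ℝ} (hα : α < 1) {ρ : ℤ → ℤˣ} {A : Finset ℤ}
    (hA : ∀ x, x ∉ A → ρ x = 1) (P : ℤ × ℤ → Prop) [DecidablePred P] :
    Summable fun p : ℤ × ℤ =>
      if ρ p.1 ≠ ρ p.2 ∧ P p then coupling α (p.1 - p.2).natAbs else 0 := by
  refine Summable.of_nonneg_of_le (fun p => ?_) (fun p => ?_) (summable_pairs hα hA)
  · split_ifs
    exacts [coupling_nonneg _ _, le_rfl]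
  · have := coupling_nonneg α (p.1 - p.2).natAbs
    split_ifs with h1 h2 h2
    exacts [le_rfl, absurd h1.1 h2, this, le_rfl]

theorem energy_mul {α : ℝ} (hα : α < 1) {τ ρ : ℤ → ℤˣ} {A B : Finset ℤ}
    (hτ : ∀ x, x ∉ A → τ x = 1) (hρ : ∀ x, x ∉ B → ρ x = 1) :
    energy α (τ * ρ) = energy α τ + energy α ρ - overlap α τ ρ := by
  have s1 := summable_pairs hα hτ
  have s2 := summable_pairs hα hρ
  have s3 := summable_overlap hα hρ fun p => τ p.1 ≠ τ p.2
  have e : (fun p : ℤ × ℤ => if (τ * ρ) p.1 ≠ (τ * ρ) p.2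
        then coupling α (p.1 - p.2).natAbs else 0)
      = fun p => (if τ p.1 ≠ τ p.2 then coupling α (p.1 - p.2).natAbs else 0)
        + (if ρ p.1 ≠ ρ p.2 then coupling α (p.1 - p.2).natAbs else 0)
        - 2 * (if ρ p.1 ≠ ρ p.2 ∧ τ p.1 ≠ τ p.2 then coupling α (p.1 - p.2).natAbs else 0) := by
    funext p
    simp only [Pi.mul_apply]
    have key : ∀ a b c d : ℤˣ, a * c ≠ b * d ↔ (a ≠ b ∧ c = d) ∨ (a = b ∧ c ≠ d) := by decide
    by_cases h1 : τ p.1 = τ p.2 <;> by_cases h2 : ρ p.1 = ρ p.2 <;>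
      simp [key, h1, h2]
    ring
  unfold energy overlap
  rw [e, (s1.add s2).tsum_sub (s3.mul_left 2), s1.tsum_add s2, tsum_mul_left]
  ring

/-! ### The spin configuration of a family of triangles -/

theorem spin_union {A B : Finset Triangle} (h : Disjoint A B) :
    spin (A ∪ B) = spin A * spin B := by
  funext x
  simp only [spin, Pi.mul_apply]
  rw [Finset.filter_union, Finset.card_union_of_disjoint (Finset.disjoint_filter_filter h), pow_add]

theorem spin_eq_of_forall_mem_iff {F : Finset Triangle} {x y : ℤ}
    (h : ∀ T ∈ F, (x ∈ T.base ↔ y ∈ T.base)) : spin F x = spin F y := by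
  simp only [spin]
  rw [Finset.filter_congr h]

theorem spin_eq_one {F : Finset Triangle} {x : ℤ} (h : x ∉ contourBase F) : spin F x = 1 := by
  have : {T ∈ F | x ∈ T.base} = ∅ := by
    rw [Finset.filter_eq_empty_iff]
    exact fun T hT hx => h (Finset.mem_biUnion.2 ⟨T, hT, hx⟩)
  rw [spin, this, Finset.card_empty, pow_zero]

theorem spin_singleton_ne_one {T : Triangle} {x : ℤ} : spin {T} x ≠ 1 ↔ x ∈ T.base := by
  by_cases h : x ∈ T.base <;> simp [spin, Finset.filter_singleton, h]

theorem Triangle.mass_eq (T : Triangle) : (T.mass : ℤ) = T.right - T.left := by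
  have := T.lt
  simp only [mass, base, Int.card_Ioc]
  omega

theorem Triangle.dist_comm (T T' : Triangle) : T.dist T' = T'.dist T := by
  have h : ∀ a b : ℤ, (a - b).natAbs = (b - a).natAbs := fun a b => by omega
  unfold dist
  rw [h T.left, h T.left, h T.right, h T.right, min_min_min_comm]

/-! ### Removing the triangles from the smallest to the largest -/

/-- `W_α(L)` as a signed sum over pairs, for an interval of length `L` in any position: `+` if the
other site lies in one of the two adjacent intervals of length `L`, and `-` if it lies beyond. -/
theorem W_eq_sum_tsum {α : ℝ} (hα : α < 1) (l : ℤ) (L : ℕ) :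
    W α L = ∑ x ∈ Finset.Ioc l (l + L), ∑' y : ℤ,
      ((if y ∈ Finset.Ioc (l + L) (l + 2 * L) ∪ Finset.Ioc (l - L) l
          then coupling α (x - y).natAbs else 0)
        - if l + 2 * L < y ∨ y ≤ l - L then coupling α (x - y).natAbs else 0) := by
  unfold W
  refine Finset.sum_bij (fun x _ => l + x) ?_ ?_ ?_ ?_
  · intro x hx
    simp only [Finset.mem_Icc, Finset.mem_Ioc] at *
    omega
  · intro a _ b _ h
    simpa using h
  · intro x hx
    simp only [Finset.mem_Ioc] at hx
    exact ⟨x - l, by simp only [Finset.mem_Icc]; omega, by omega⟩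
  · intro x _
    have hs := summable_coupling_sub hα (l + x)
    have s1 := summable_of_ne_finset_zero (L := .unconditional ℤ)
      (f := fun y => if y ∈ Finset.Ioc (l + L) (l + 2 * L) ∪ Finset.Ioc (l - L) l
        then coupling α (l + x - y).natAbs else 0)
      (s := Finset.Ioc (l + L) (l + 2 * L) ∪ Finset.Ioc (l - L) l) (fun y hy => if_neg hy)
    have s2 : Summable fun y : ℤ =>
        if l + 2 * L < y ∨ y ≤ l - L then coupling α (l + x - y).natAbs else 0 :=
      (hs.indicator {y : ℤ | l + 2 * L < y ∨ y ≤ l - L}).congr fun y => by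
        simp [Set.indicator]
    rw [s1.tsum_sub s2]
    congr 1
    · rw [tsum_eq_sum (s := Finset.Ioc (l + L) (l + 2 * L) ∪ Finset.Ioc (l - L) l)
        (fun y hy => if_neg hy)]
      refine Finset.sum_bij (fun y _ => l + y) ?_ ?_ ?_ ?_
      · intro y hy
        simp only [Finset.mem_union, Finset.mem_Icc, Finset.mem_Ioc] at *
        omega
      · intro a _ b _ h
        simpa using h
      · intro y hy
        simp only [Finset.mem_union, Finset.mem_Ioc] at hy
        exact ⟨y - l, by simp only [Finset.mem_union, Finset.mem_Icc]; omega, by omega⟩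
      · intro y hy
        rw [if_pos]
        · congr 2
          omega
        · simp only [Finset.mem_union, Finset.mem_Icc, Finset.mem_Ioc] at *
          omega
    · have h := tsum_subtype {y : ℤ | 2 * (L : ℤ) + 1 ≤ y ∨ y ≤ -(L : ℤ)}
        fun y => coupling α (x - y).natAbs
      refine h.trans (Eq.trans (tsum_congr fun y => ?_) ((Equiv.addLeft l).tsum_eq _))
      simp only [Set.indicator, Set.mem_ofPred_eq, Equiv.coe_addLeft]
      have e1 : (2 * (L : ℤ) + 1 ≤ y ∨ y ≤ -(L : ℤ)) ↔ (l + 2 * L < l + y ∨ l + y ≤ l - L) := by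
        omega
      have e2 : (l + x - (l + y)).natAbs = (x - y).natAbs := by congr 1; omega
      simp only [e1, e2]

/-- Flipping an interval of length `L` inside a region where the configuration is constant up to
distance `L` raises the energy by at least `W_α(L)`. -/
theorem W_le_energy_sub_overlap {α : ℝ} (hα : α < 1) {τ : ℤ → ℤˣ} (T : Triangle)
    (hτ : ∀ x ∈ Finset.Ioc (T.left - T.mass) (T.right + T.mass),
      ∀ y ∈ Finset.Ioc (T.left - T.mass) (T.right + T.mass), τ x = τ y) :
    W α T.mass ≤ energy α (spin {T}) - overlap α τ (spin {T}) := by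
  have hm := T.mass_eq
  have hA : ∀ x, x ∉ T.base → spin {T} x = 1 := fun x hx => by
    by_contra h
    exact hx (spin_singleton_ne_one.1 h)
  have hne : ∀ x y, spin {T} x ≠ spin {T} y ↔ ¬ (x ∈ T.base ↔ y ∈ T.base) := by
    intro x y
    by_cases hx : x ∈ T.base <;> by_cases hy : y ∈ T.base <;>
      simp [spin, Finset.filter_singleton, hx, hy]
  have hov : overlap α τ (spin {T}) = 2 * ∑ x ∈ T.base, ∑' y : ℤ,
      if spin {T} x ≠ spin {T} y ∧ τ x ≠ τ y then coupling α (x - y).natAbs else 0 := by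
    refine tsum_pairs_eq (summable_overlap hα hA fun p => τ p.1 ≠ τ p.2) ?_ ?_
    · intro x y
      simp only [show (y - x).natAbs = (x - y).natAbs by omega, ne_comm]
    · intro x y h
      have h1 : spin {T} x ≠ spin {T} y := by
        by_contra h'
        simp [h'] at h
      have := (hne x y).1 h1
      tauto
  rw [hov, energy_eq_sum_siteEnergy (A := T.base) hα (fun x => spin_singleton_ne_one.symm),
    Finset.mul_sum, ← Finset.sum_sub_distrib, W_eq_sum_tsum hα T.left]
  have hr : T.left + (T.mass : ℤ) = T.right := by omega
  have hr2 : T.left + 2 * (T.mass : ℤ) = T.right + T.mass := by omega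
  rw [hr, hr2]
  refine Finset.sum_le_sum fun x hx => ?_
  change x ∈ T.base at hx
  have hs := summable_coupling_sub hα x
  have s (P : ℤ → Prop) [DecidablePred P] :
      Summable fun y => if P y then coupling α (x - y).natAbs else 0 :=
    (hs.indicator {y | P y}).congr fun y => by simp [Set.indicator]
  unfold siteEnergy
  rw [← tsum_mul_left, ← (s _).tsum_sub ((s _).mul_left 2)]
  refine Summable.tsum_le_tsum (fun y => ?_) ((s _).sub (s _)) ((s _).sub ((s _).mul_left 2))
  have hJ := coupling_nonneg α (x - y).natAbs
  by_cases hy : y ∈ T.base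
  · have h1 : ¬ spin {T} x ≠ spin {T} y := by rw [hne]; simp [hx, hy]
    simp only [h1, if_false, false_and]
    have hy' := hy
    rw [Triangle.base, Finset.mem_Ioc] at hy'
    rw [if_neg, if_neg]
    · simp
    · omega
    · simp only [Finset.mem_union, Finset.mem_Ioc]
      omega
  · have h1 : spin {T} x ≠ spin {T} y := by rw [hne]; simp [hx, hy]
    simp only [h1, true_and, if_true, ne_eq, not_false_eq_true]
    rw [Triangle.base, Finset.mem_Ioc] at hx hy
    by_cases hnear : y ∈ Finset.Ioc T.right (T.right + T.mass)
        ∪ Finset.Ioc (T.left - T.mass) T.left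
    · rw [if_pos hnear]
      simp only [Finset.mem_union, Finset.mem_Ioc] at hnear
      rw [if_neg (by omega), if_neg]
      · simp
      · rw [not_not]
        apply hτ <;> simp only [Finset.mem_Ioc] <;> omega
    · rw [if_neg hnear]
      simp only [Finset.mem_union, Finset.mem_Ioc] at hnear
      rw [if_pos (by omega)]
      split_ifs <;> linarith

/-- In a family of triangles whose mutual distances are at least the smaller of the two masses, each
triangle `T` contributes at least `W_α(|T|)` to the energy. -/
theorem sum_W_le_energy {α : ℝ} (hα : α < 1) (F : Finset Triangle)
    (hF : ∀ T ∈ F, ∀ T' ∈ F, T ≠ T' → min T.mass T'.mass ≤ T.dist T') :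
    ∑ T ∈ F, W α T.mass ≤ energy α (spin F) := by
  induction F using Finset.strongInduction with
  | H F ih =>
  rcases F.eq_empty_or_nonempty with rfl | hne
  · simpa using energy_nonneg α _
  obtain ⟨T, hT, hmin⟩ := F.exists_min_image Triangle.mass hne
  have ih' := ih (F.erase T) (Finset.erase_ssubset hT) fun S hS S' hS' =>
    hF S (Finset.mem_of_mem_erase hS) S' (Finset.mem_of_mem_erase hS')
  have hsplit : spin F = spin (F.erase T) * spin {T} := by
    rw [← spin_union (by simp), Finset.union_comm, ← Finset.insert_eq, Finset.insert_erase hT]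
  have hW := W_le_energy_sub_overlap hα (τ := spin (F.erase T)) T ?_
  · rw [hsplit, energy_mul hα (fun x hx => spin_eq_one hx) (fun x hx => spin_eq_one hx),
      ← Finset.sum_erase_add _ _ hT]
    linarith
  -- no other triangle has a spin-flip point within distance `|T|` of those of `T`
  intro x hx y hy
  refine spin_eq_of_forall_mem_iff fun S hS => ?_
  have hd := hF T hT S (Finset.mem_of_mem_erase hS) (Finset.ne_of_mem_erase hS).symm
  rw [min_eq_left (hmin S (Finset.mem_of_mem_erase hS))] at hd
  have hm := T.mass_eq
  have hpos := T.lt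
  have hlt := S.lt
  simp only [Triangle.dist, le_min_iff] at hd
  obtain ⟨⟨d1, d2⟩, d3, d4⟩ := hd
  simp only [Triangle.base, Finset.mem_Ioc] at hx hy ⊢
  generalize T.mass = m at *
  have a1 : S.left ≤ T.left - m ∨ T.right + m ≤ S.left := by omega
  have a2 : S.right ≤ T.left - m ∨ T.right + m ≤ S.right := by omega
  omega

/-! ### Distances in compatible families -/

/-- The roots differ so little from the spin-flip points that they do not reverse strict
inequalities between distances. -/
theorem IsRootChoice.natAbs_le {r : ℤ → ℝ} (hr : IsRootChoice r) {a b c d : ℤ}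
    (h : |r a - r b| ≤ |r c - r d|) : (a - b).natAbs ≤ (c - d).natAbs := by
  have ha := hr.near a
  have hb := hr.near b
  have hc := hr.near c
  have hd := hr.near d
  simp only [Set.mem_Icc] at ha hb hc hd
  have h1 : |((a - b : ℤ) : ℝ)| ≤ |r a - r b| + 1 / 50 := by
    push_cast
    have := abs_sub_abs_le_abs_sub ((a : ℝ) - b) (r a - r b)
    have h2 : |((a : ℝ) - b) - (r a - r b)| ≤ 1 / 50 := abs_le.2 ⟨by linarith, by linarith⟩
    linarith
  have h3 : |r c - r d| ≤ |((c - d : ℤ) : ℝ)| + 1 / 50 := by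
    push_cast
    have := abs_sub_abs_le_abs_sub (r c - r d) ((c : ℝ) - d)
    have h2 : |(r c - r d) - ((c : ℝ) - d)| ≤ 1 / 50 := abs_le.2 ⟨by linarith, by linarith⟩
    linarith
  have h4 : ((a - b).natAbs : ℝ) < ((c - d).natAbs : ℝ) + 1 := by
    rw [Nat.cast_natAbs, Nat.cast_natAbs, Int.cast_abs, Int.cast_abs]
    linarith
  have h5 : (a - b).natAbs < (c - d).natAbs + 1 := by exact_mod_cast h4
  omega

theorem Triangulates.min_mass_le_dist {r : ℤ → ℝ} (hr : IsRootChoice r) {S : Finset ℤ}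
    {F : Finset Triangle} (h : Triangulates r S F) :
    (∀ T ∈ F, T.left ∈ S ∧ T.right ∈ S) ∧
      ∀ T ∈ F, ∀ T' ∈ F, T ≠ T' → min T.mass T'.mass ≤ T.dist T' := by
  induction h with
  | nil => simp
  | step S F T hl hrt hmin hF ih =>
    obtain ⟨ih1, ih2⟩ := ih
    have hnew : ∀ T' ∈ F, T.mass ≤ T.dist T' := by
      intro T' hT'
      obtain ⟨h1, h2⟩ := ih1 T' hT'
      simp only [Finset.mem_sdiff, Finset.mem_insert, Finset.mem_singleton, not_or] at h1 h2
      have hm : T.mass = (T.left - T.right).natAbs := by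
        have := T.mass_eq
        omega
      rw [hm]
      simp only [Triangle.dist, le_min_iff]
      exact ⟨⟨hr.natAbs_le (hmin _ hl _ h1.1 (Ne.symm h1.2.1)),
        hr.natAbs_le (hmin _ hl _ h2.1 (Ne.symm h2.2.1))⟩,
        hr.natAbs_le (hmin _ hrt _ h1.1 (Ne.symm h1.2.2)),
        hr.natAbs_le (hmin _ hrt _ h2.1 (Ne.symm h2.2.2))⟩
    refine ⟨fun T' hT' => ?_, fun A hA B hB hAB => ?_⟩
    · rcases Finset.mem_insert.1 hT' with rfl | h
      · exact ⟨hl, hrt⟩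
      · have := ih1 T' h
        exact ⟨(Finset.mem_sdiff.1 this.1).1, (Finset.mem_sdiff.1 this.2).1⟩
    · rcases Finset.mem_insert.1 hA with rfl | hA' <;> rcases Finset.mem_insert.1 hB with rfl | hB'
      · exact absurd rfl hAB
      · exact (min_le_left _ _).trans (hnew B hB')
      · rw [Triangle.dist_comm]
        exact (min_le_right _ _).trans (hnew A hA')
      · exact ih2 A hA' B hB' hAB

/-! ### Separated triangles and contours -/

/-- The sites at which the configuration of `F` is `-1`. -/
noncomputable def minusSites (F : Finset Triangle) : Finset ℤ := {x ∈ contourBase F | spin F x ≠ 1}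

theorem mem_minusSites {F : Finset Triangle} {x : ℤ} : x ∈ minusSites F ↔ spin F x ≠ 1 := by
  refine ⟨fun h => (Finset.mem_filter.1 h).2, fun h => Finset.mem_filter.2 ⟨?_, h⟩⟩
  by_contra h'
  exact h (spin_eq_one h')

theorem minusSites_subset (F : Finset Triangle) : minusSites F ⊆ contourBase F :=
  Finset.filter_subset _ _

theorem card_minusSites_le (F : Finset Triangle) : (minusSites F).card ≤ contourMass F :=
  (Finset.card_le_card (minusSites_subset F)).trans Finset.card_biUnion_le

theorem contourMass_pos {F : Finset Triangle} (h : F.Nonempty) : 1 ≤ contourMass F := by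
  obtain ⟨T, hT⟩ := h
  have h1 : T.mass ≤ contourMass F :=
    Finset.single_le_sum (f := Triangle.mass) (fun _ _ => Nat.zero_le _) hT
  have := T.mass_eq
  have := T.lt
  omega

theorem Triangle.dist_le_natAbs_of_mem_iff {T T' : Triangle} (h : T.mass < T.dist T') {z w : ℤ}
    (hz : z ∈ T.base) (hw : ¬ (z ∈ T'.base ↔ w ∈ T'.base)) : T.dist T' ≤ (z - w).natAbs := by
  have hm := T.mass_eq
  have hlt := T'.lt
  have hd : T.dist T' ≤ min (min (T.left - T'.left).natAbs (T.left - T'.right).natAbs)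
    (min (T.right - T'.left).natAbs (T.right - T'.right).natAbs) := le_rfl
  generalize T.dist T' = d at h hd ⊢
  simp only [le_min_iff] at hd
  obtain ⟨⟨d1, d2⟩, d3, d4⟩ := hd
  simp only [Triangle.base, Finset.mem_Ioc] at hz hw
  omega

theorem Triangle.dist_le_natAbs_of_mem {T T' : Triangle} (h : T.mass < T.dist T')
    (h' : T'.mass < T.dist T') {z w : ℤ} (hz : z ∈ T.base) (hw : w ∈ T'.base) :
    T.dist T' ≤ (z - w).natAbs := by
  have hm := T.mass_eq
  have hm' := T'.mass_eq
  refine Triangle.dist_le_natAbs_of_mem_iff h hz fun hzw => ?_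
  have hz' := hzw.2 hw
  have hd : T.dist T' ≤ (T.left - T'.left).natAbs := (min_le_left _ _).trans (min_le_left _ _)
  simp only [Triangle.base, Finset.mem_Ioc] at hz hz'
  omega

theorem mass_le_mul_cube {c : ℝ} (hc : 1 ≤ c) {Γ : Finset Triangle} {T : Triangle} (hT : T ∈ Γ) :
    (T.mass : ℝ) ≤ c * (contourMass Γ : ℝ) ^ 3 := by
  have h1 : T.mass ≤ contourMass Γ :=
    Finset.single_le_sum (f := Triangle.mass) (fun _ _ => Nat.zero_le _) hT
  have h2 : contourMass Γ ≤ contourMass Γ ^ 3 := Nat.le_self_pow (by norm_num) _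
  have h3 : (T.mass : ℝ) ≤ (contourMass Γ : ℝ) ^ 3 := by exact_mod_cast h1.trans h2
  have h4 : (0 : ℝ) ≤ (contourMass Γ : ℝ) ^ 3 := by positivity
  nlinarith

/-- A site in the base of `Γ` is far from every site from which it is separated by a triangle of a
larger contour `Γ'`. -/
theorem WellSeparated.lt_of_not_mem_iff {c : ℝ} (hc : 1 ≤ c) {Γ Γ' : Finset Triangle}
    (h : WellSeparated c Γ Γ') (hle : contourMass Γ ≤ contourMass Γ') {z w : ℤ}
    (hz : z ∈ contourBase Γ) {T' : Triangle} (hT' : T' ∈ Γ')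
    (hne : ¬ (z ∈ T'.base ↔ w ∈ T'.base)) :
    c * (contourMass Γ : ℝ) ^ 3 < ((z - w).natAbs : ℝ) := by
  obtain ⟨T, hT, hzT⟩ := Finset.mem_biUnion.1 hz
  have hd := h.2 T hT T' hT'
  rw [min_eq_left (by exact_mod_cast hle)] at hd
  have hm : T.mass < T.dist T' := by exact_mod_cast (mass_le_mul_cube hc hT).trans_lt hd
  exact hd.trans_le (by exact_mod_cast Triangle.dist_le_natAbs_of_mem_iff hm hzT hne)

/-- The bases of two contours of equal mass are far apart. -/
theorem WellSeparated.lt_of_mem {c : ℝ} (hc : 1 ≤ c) {Γ Γ' : Finset Triangle}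
    (h : WellSeparated c Γ Γ') (he : contourMass Γ = contourMass Γ') {z w : ℤ}
    (hz : z ∈ contourBase Γ) (hw : w ∈ contourBase Γ') :
    c * (contourMass Γ : ℝ) ^ 3 < ((z - w).natAbs : ℝ) := by
  obtain ⟨T, hT, hzT⟩ := Finset.mem_biUnion.1 hz
  obtain ⟨T', hT', hwT⟩ := Finset.mem_biUnion.1 hw
  have hd := h.2 T hT T' hT'
  rw [← he, min_self] at hd
  have hm : T.mass < T.dist T' := by exact_mod_cast (mass_le_mul_cube hc hT).trans_lt hd
  have hm' : T'.mass < T.dist T' := by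
    exact_mod_cast (he ▸ mass_le_mul_cube hc hT' :
      (T'.mass : ℝ) ≤ c * (contourMass Γ : ℝ) ^ 3).trans_lt hd
  exact hd.trans_le (by exact_mod_cast Triangle.dist_le_natAbs_of_mem hm hm' hzT hwT)

theorem WellSeparated.symm {c : ℝ} {Γ Γ' : Finset Triangle} (h : WellSeparated c Γ Γ') :
    WellSeparated c Γ' Γ := by
  refine ⟨?_, fun T hT T' hT' => ?_⟩
  · rcases h.1 with h1 | h1 | h1
    exacts [Or.inl h1.symm, Or.inr (Or.inr h1), Or.inr (Or.inl h1)]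
  · rw [min_comm, Triangle.dist_comm]
    exact h.2 T' hT' T hT

theorem exists_not_mem_base_iff {F : Finset Triangle} {x y : ℤ} (h : spin F x ≠ spin F y) :
    ∃ T ∈ F, ¬ (x ∈ T.base ↔ y ∈ T.base) := by
  by_contra! h'
  exact h (spin_eq_of_forall_mem_iff h')

/-! ### Estimates for the energy of a site -/

/-- A set of `M` minus sites cannot fill the interval of radius `M` about one of its points. -/
theorem rpow_card_le_siteEnergy {α : ℝ} (hα : α < 1) {ρ : ℤ → ℤˣ} {A : Finset ℤ}
    (hA : ∀ x, x ∈ A ↔ ρ x ≠ 1) {x : ℤ} (hx : x ∈ A) :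
    (A.card : ℝ) ^ (α - 1) ≤ siteEnergy α ρ x := by
  set M := A.card with hM
  have hM1 : 1 ≤ M := Finset.card_pos.2 ⟨x, hx⟩
  have hM1' : (0 : ℝ) < M := by exact_mod_cast hM1
  set B := Finset.Icc (x - M) (x + M) \ A with hB
  have hBcard : M ≤ B.card := by
    have h1 : (Finset.Icc (x - M) (x + M)).card - A.card ≤ B.card := Finset.le_card_sdiff A _
    rw [Int.card_Icc] at h1
    omega
  have hs : Summable fun w : ℤ => if ρ x ≠ ρ w then coupling α (x - w).natAbs else 0 :=
    ((summable_coupling_sub hα x).indicator {w | ρ x ≠ ρ w}).congr fun y => by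
      simp [Set.indicator]
  calc (M : ℝ) ^ (α - 1) = M * coupling α M := by
        rw [coupling, show α - 1 = 1 + (-2 + α) by ring, Real.rpow_add hM1', Real.rpow_one]
    _ ≤ B.card * coupling α M :=
        mul_le_mul_of_nonneg_right (by exact_mod_cast hBcard) (coupling_nonneg _ _)
    _ = ∑ _y ∈ B, coupling α M := by rw [Finset.sum_const, nsmul_eq_mul]
    _ ≤ ∑ y ∈ B, if ρ x ≠ ρ y then coupling α (x - y).natAbs else 0 := by
        refine Finset.sum_le_sum fun y hy => ?_
        rw [hB, Finset.mem_sdiff, Finset.mem_Icc] at hy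
        have hne : ρ x ≠ ρ y := by
          have h1 := (hA x).1 hx
          have h2 : ρ y = 1 := by
            by_contra h'
            exact hy.2 ((hA y).2 h')
          rwa [h2]
        have hxy : x ≠ y := fun e => hne (by rw [e])
        rw [if_pos hne]
        exact coupling_anti hα (by omega) (by omega)
    _ ≤ siteEnergy α ρ x := by
        refine Summable.sum_le_tsum B (fun y _ => ?_) hs
        split_ifs
        exacts [coupling_nonneg _ _, le_rfl]

theorem tsum_coupling_far_le {α : ℝ} (h0 : 0 ≤ α) (hα : α < 1) (x : ℤ) {R : ℝ} (hR : 1 ≤ R) :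
    ∑' y : ℤ, (if R < ((x - y).natAbs : ℝ) then coupling α (x - y).natAbs else 0)
      ≤ 2 / (1 - α) * (R / 2) ^ (α - 1) := by
  set K := ⌊R⌋₊ with hK
  have hK1 : 1 ≤ K := Nat.one_le_floor_iff _ |>.2 hR
  have hKR : R / 2 ≤ K := by
    have h1 := Nat.lt_floor_add_one R
    have h2 : (1 : ℝ) ≤ K := by exact_mod_cast hK1
    linarith
  have hsum := (hasSum_coupling_two_sided hα x (m := K + 1) (n := K + 1) (by omega)).tsum_eq
  have e : ∑' y : ℤ, (if R < ((x - y).natAbs : ℝ) then coupling α (x - y).natAbs else 0)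
      = couplingTail α (K + 1) + couplingTail α (K + 1) := by
    rw [← hsum]
    refine Eq.trans (tsum_congr fun y => ?_)
      (tsum_subtype {y : ℤ | x + ((K + 1 : ℕ) : ℤ) ≤ y ∨ y ≤ x - ((K + 1 : ℕ) : ℤ)}
        fun y => coupling α (x - y).natAbs).symm
    have h1 : R < ((x - y).natAbs : ℝ)
        ↔ (x + ((K + 1 : ℕ) : ℤ) ≤ y ∨ y ≤ x - ((K + 1 : ℕ) : ℤ)) := by
      rw [← Nat.floor_lt (by linarith)]
      omega
    simp only [Set.indicator, Set.mem_ofPred_eq, h1]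
  have h1 := couplingTail_succ_le h0 hα hK1
  have h2 : (K : ℝ) ^ (α - 1) ≤ (R / 2) ^ (α - 1) :=
    Real.rpow_le_rpow_of_nonpos (by linarith) hKR (by linarith)
  have h3 : (K : ℝ) ^ (α - 1) / (1 - α) ≤ (R / 2) ^ (α - 1) / (1 - α) :=
    div_le_div_of_nonneg_right h2 (by linarith)
  rw [e]
  calc _ ≤ 2 * ((R / 2) ^ (α - 1) / (1 - α)) := by linarith
    _ = _ := by ring

/-- If `ρ` is constant within distance `R` of `z`, then the energy of `z` is comparable to that of
every site within distance `R`. -/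
theorem siteEnergy_le_four_mul {α : ℝ} (h0 : 0 ≤ α) (hα : α < 1) {ρ : ℤ → ℤˣ} {z z' : ℤ} {R : ℕ}
    (hR : ∀ w, ρ z ≠ ρ w → R < (z - w).natAbs) (hz : (z - z').natAbs ≤ R) :
    siteEnergy α ρ z ≤ 4 * siteEnergy α ρ z' := by
  have e : ρ z' = ρ z := by
    by_contra h
    exact absurd (hR z' (Ne.symm h)) (by omega)
  have s (x : ℤ) : Summable fun w : ℤ => if ρ x ≠ ρ w then coupling α (x - w).natAbs else 0 :=
    ((summable_coupling_sub hα x).indicator {w | ρ x ≠ ρ w}).congr fun y => by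
      simp [Set.indicator]
  unfold siteEnergy
  rw [← tsum_mul_left]
  refine Summable.tsum_le_tsum (fun w => ?_) (s z) ((s z').mul_left 4)
  rw [e]
  split_ifs with hw
  · have h1 := hR w hw
    have h2 : z' ≠ w := fun h => hw (by rw [← h, e])
    set n := (z - w).natAbs with hn
    have h3 : coupling α (2 * n) ≤ coupling α (z' - w).natAbs :=
      coupling_anti hα (by omega) (by omega)
    have h4 : coupling α n ≤ 4 * coupling α (2 * n) := by
      simp only [coupling]
      push_cast
      rw [Real.mul_rpow (by norm_num) (Nat.cast_nonneg n), ← mul_assoc]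
      refine le_mul_of_one_le_left (by positivity) ?_
      have : (2 : ℝ) ^ (-2 : ℝ) ≤ 2 ^ (-2 + α) :=
        Real.rpow_le_rpow_of_exponent_le (by norm_num) (by linarith)
      have h5 : (2 : ℝ) ^ (-2 : ℝ) = 1 / 4 := by
        rw [Real.rpow_neg (by norm_num)]
        norm_num
      rw [h5] at this
      generalize (2 : ℝ) ^ (-2 + α) = t at this ⊢
      linarith
    linarith
  · simp

/-! ### The covering argument -/

theorem sum_one_div_sq_le_two (S : Finset ℕ) : ∑ n ∈ S, 1 / (n : ℝ) ^ 2 ≤ 2 := by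
  have h1 : ∑ n ∈ S, coupling 0 n ≤ couplingTail 0 0 :=
    (summable_coupling one_pos).sum_le_tsum S fun n _ => coupling_nonneg _ _
  have h2 := couplingTail_eq (α := 0) one_pos 0
  have h3 := couplingTail_le (n := 1) le_rfl
  rw [coupling_zero one_pos] at h2
  simp only [coupling_zero_left] at h1
  norm_num at h3 h2
  linarith

/-- Let the sets `A i` have at most `m i` points, and let `f` be nonnegative and nearly constant
on the balls of radius `R i`, of order at least `(m i) ^ 3`, about the points of `A i`. If balls
belonging to different sets with equal `m` never meet, then each point lies in balls of at most
one set for each value of `m`, so that the sum of `f` over all the sets is small compared with its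
total sum, as `∑ m / m ^ 3` converges. -/
theorem sum_sum_le_of_balls_disjoint {ι : Type*} (S : Finset ι) (m R : ι → ℕ) (A : ι → Finset ℤ)
    {K : ℝ} (hK : 0 < K) {f : ℤ → ℝ} (hf : ∀ z, 0 ≤ f z) (hfs : Summable f)
    (hm : ∀ i ∈ S, 1 ≤ m i) (hcard : ∀ i ∈ S, (A i).card ≤ m i)
    (hR : ∀ i ∈ S, K * (m i : ℝ) ^ 3 ≤ 2 * R i + 1)
    (hball : ∀ i ∈ S, ∀ z ∈ A i, ∀ z', (z - z').natAbs ≤ R i → f z ≤ 4 * f z')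
    (hdisj : ∀ i ∈ S, ∀ j ∈ S, i ≠ j → m i = m j → ∀ z ∈ A i, ∀ w ∈ A j,
      R i + R j < (z - w).natAbs) :
    ∑ i ∈ S, ∑ z ∈ A i, f z ≤ 8 / K * ∑' z, f z := by
  classical
  set Z : Finset ℤ := S.biUnion fun i => (A i).biUnion fun z => Finset.Icc (z - R i) (z + R i)
    with hZ
  have hone : ∀ i ∈ S, ∀ z ∈ A i,
      f z ≤ ∑ z' ∈ Z, if (z - z').natAbs ≤ R i then 4 / (K * (m i : ℝ) ^ 3) * f z' else 0 := by
    intro i hi z hz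
    have hm' : (0 : ℝ) < m i := by exact_mod_cast hm i hi
    have hKm : 0 < K * (m i : ℝ) ^ 3 := by positivity
    have hsub : Finset.Icc (z - R i) (z + R i) ⊆ Z := fun w hw =>
      Finset.mem_biUnion.2 ⟨i, hi, Finset.mem_biUnion.2 ⟨z, hz, hw⟩⟩
    have hin : ∀ w, w ∈ Finset.Icc (z - R i) (z + R i) → (z - w).natAbs ≤ R i := by
      intro w hw
      rw [Finset.mem_Icc] at hw
      omega
    have h1 : ∑ _w ∈ Finset.Icc (z - R i) (z + R i), f z
        ≤ ∑ w ∈ Finset.Icc (z - R i) (z + R i), 4 * f w :=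
      Finset.sum_le_sum fun w hw => hball i hi z hz w (hin w hw)
    rw [Finset.sum_const, nsmul_eq_mul, Int.card_Icc,
      show (z + R i + 1 - (z - R i)).toNat = 2 * R i + 1 by omega, ← Finset.mul_sum] at h1
    push_cast at h1
    have h2 : K * (m i : ℝ) ^ 3 * f z ≤ (2 * R i + 1) * f z :=
      mul_le_mul_of_nonneg_right (hR i hi) (hf z)
    have h3 : f z ≤ 4 / (K * (m i : ℝ) ^ 3) * ∑ w ∈ Finset.Icc (z - R i) (z + R i), f w := by
      rw [div_mul_eq_mul_div, le_div_iff₀ hKm]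
      linarith
    refine h3.trans ?_
    rw [Finset.mul_sum]
    calc _ = ∑ w ∈ Finset.Icc (z - R i) (z + R i),
          if (z - w).natAbs ≤ R i then 4 / (K * (m i : ℝ) ^ 3) * f w else 0 :=
          Finset.sum_congr rfl fun w hw => (if_pos (hin w hw)).symm
      _ ≤ _ := Finset.sum_le_sum_of_subset_of_nonneg hsub fun w _ _ => by
          split_ifs
          exacts [mul_nonneg (by positivity) (hf w), le_rfl]
  have hweight : ∀ z' : ℤ, ∑ i ∈ S, ∑ z ∈ A i,
      (if (z - z').natAbs ≤ R i then 4 / (K * (m i : ℝ) ^ 3) * f z' else 0) ≤ 8 / K * f z' := by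
    intro z'
    set S' := {i ∈ S | ∃ z ∈ A i, (z - z').natAbs ≤ R i} with hS'
    have hinj : Set.InjOn m S' := by
      intro i hi j hj hij
      rw [hS', Finset.mem_coe, Finset.mem_filter] at hi hj
      obtain ⟨hi, z, hz, hzi⟩ := hi
      obtain ⟨hj, w, hw, hwj⟩ := hj
      by_contra hne
      have := hdisj i hi j hj hne hij z hz w hw
      omega
    have hterm : ∀ i ∈ S, ∑ z ∈ A i,
        (if (z - z').natAbs ≤ R i then 4 / (K * (m i : ℝ) ^ 3) * f z' else 0)
        ≤ if ∃ z ∈ A i, (z - z').natAbs ≤ R i then 4 / K * f z' * (1 / (m i : ℝ) ^ 2) else 0 := by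
      intro i hi
      have hm' : (0 : ℝ) < m i := by exact_mod_cast hm i hi
      have hnn : 0 ≤ 4 / (K * (m i : ℝ) ^ 3) * f z' := mul_nonneg (by positivity) (hf z')
      split_ifs with h
      · calc _ ≤ ∑ z ∈ A i, 4 / (K * (m i : ℝ) ^ 3) * f z' :=
              Finset.sum_le_sum fun z _ => by split_ifs; exacts [le_rfl, hnn]
          _ = (A i).card * (4 / (K * (m i : ℝ) ^ 3) * f z') := by
              rw [Finset.sum_const, nsmul_eq_mul]
          _ ≤ m i * (4 / (K * (m i : ℝ) ^ 3) * f z') :=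
              mul_le_mul_of_nonneg_right (by exact_mod_cast hcard i hi) hnn
          _ = _ := by field_simp
      · refine (Finset.sum_eq_zero fun z hz => if_neg fun h' => h ⟨z, hz, h'⟩).le
    refine (Finset.sum_le_sum hterm).trans ?_
    rw [← Finset.sum_filter, ← hS', ← Finset.mul_sum,
      ← Finset.sum_image (f := fun n : ℕ => 1 / (n : ℝ) ^ 2) hinj]
    have h2 := sum_one_div_sq_le_two (S'.image m)
    have h3 : 0 ≤ 4 / K * f z' := mul_nonneg (by positivity) (hf z')
    calc _ ≤ 4 / K * f z' * 2 := mul_le_mul_of_nonneg_left h2 h3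
      _ = _ := by ring
  calc ∑ i ∈ S, ∑ z ∈ A i, f z
      ≤ ∑ i ∈ S, ∑ z ∈ A i, ∑ z' ∈ Z,
        (if (z - z').natAbs ≤ R i then 4 / (K * (m i : ℝ) ^ 3) * f z' else 0) :=
        Finset.sum_le_sum fun i hi => Finset.sum_le_sum fun z hz => hone i hi z hz
    _ = ∑ z' ∈ Z, ∑ i ∈ S, ∑ z ∈ A i,
        (if (z - z').natAbs ≤ R i then 4 / (K * (m i : ℝ) ^ 3) * f z' else 0) := by
        symm
        rw [Finset.sum_comm]
        exact Finset.sum_congr rfl fun i _ => Finset.sum_comm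
    _ ≤ ∑ z' ∈ Z, 8 / K * f z' := Finset.sum_le_sum fun z' _ => hweight z'
    _ = 8 / K * ∑ z' ∈ Z, f z' := by rw [Finset.mul_sum]
    _ ≤ _ := mul_le_mul_of_nonneg_left (hfs.sum_le_tsum Z fun z _ => hf z) (by positivity)

/-! ### The interaction of a contour with the other contours -/

/-- The pairs on which `ρ` disagrees and whose first site lies in `B`. -/
theorem tsum_pairs_fst_mem {α : ℝ} (hα : α < 1) {ρ : ℤ → ℤˣ} {A : Finset ℤ}
    (hA : ∀ x, x ∉ A → ρ x = 1) (B : Finset ℤ) :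
    ∑' p : ℤ × ℤ, (if ρ p.1 ≠ ρ p.2 ∧ p.1 ∈ B then coupling α (p.1 - p.2).natAbs else 0)
      = ∑ z ∈ B, siteEnergy α ρ z := by
  rw [(summable_overlap hα hA fun p => p.1 ∈ B).tsum_prod, tsum_eq_sum (s := B)]
  · refine Finset.sum_congr rfl fun z hz => ?_
    simp [hz, siteEnergy]
  · intro z hz
    simp [hz]

/-- The contours smaller than `Γ`: each of them lies in a neighbourhood, large compared with its
mass, in which the configuration of `Γ` is constant. -/
theorem sum_siteEnergy_small_le {α c : ℝ} (h0 : 0 ≤ α) (hα : α < 1) (hc : 4 ≤ c)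
    {Γ : Finset Triangle} {S : Finset (Finset Triangle)} (hne : ∀ Γ' ∈ S, Γ'.Nonempty)
    (hle : ∀ Γ' ∈ S, contourMass Γ' ≤ contourMass Γ) (hΓ : ∀ Γ' ∈ S, WellSeparated c Γ' Γ)
    (hS : ∀ Γ' ∈ S, ∀ Γ'' ∈ S, Γ' ≠ Γ'' → WellSeparated c Γ' Γ'') :
    ∑ Γ' ∈ S, ∑ z ∈ contourBase Γ', siteEnergy α (spin Γ) z
      ≤ 64 / c * energy α (spin Γ) := by
  have hsum := hasSum_siteEnergy (A := contourBase Γ) hα fun x hx => spin_eq_one (F := Γ) hx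
  have hfl : ∀ Γ' : Finset Triangle, 0 ≤ c * (contourMass Γ' : ℝ) ^ 3 := fun Γ' => by positivity
  -- the radius is a quarter of the separation: the configuration of `Γ` is constant on each
  -- ball, and the balls of two contours of equal mass do not meet
  have key := sum_sum_le_of_balls_disjoint S contourMass
    (fun Γ' => ⌊c * (contourMass Γ' : ℝ) ^ 3 / 4⌋₊) contourBase (K := c / 4) (by positivity)
    (siteEnergy_nonneg α (spin Γ)) hsum.summable (fun Γ' h => contourMass_pos (hne Γ' h))
    (fun Γ' _ => Finset.card_biUnion_le) ?_ ?_ ?_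
  · rw [hsum.tsum_eq] at key
    refine key.trans (le_of_eq ?_)
    field_simp
    ring
  · intro Γ' h
    have h1 : (1 : ℝ) ≤ contourMass Γ' := by exact_mod_cast contourMass_pos (hne Γ' h)
    have h2 : (1 : ℝ) ≤ (contourMass Γ' : ℝ) ^ 3 := one_le_pow₀ h1
    have h3 := Nat.lt_floor_add_one (c * (contourMass Γ' : ℝ) ^ 3 / 4)
    nlinarith
  · intro Γ' h z hz z' hzz'
    refine siteEnergy_le_four_mul h0 hα (fun w hw => ?_) hzz'
    obtain ⟨T, hT, hsep⟩ := exists_not_mem_base_iff hw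
    have h1 := (hΓ Γ' h).lt_of_not_mem_iff (by linarith) (hle Γ' h) hz hT hsep
    rw [Nat.floor_lt (by linarith [hfl Γ'])]
    linarith [hfl Γ']
  · intro Γ' h Γ'' h' hne' hm z hz w hw
    have h1 := (hS Γ' h Γ'' h' hne').lt_of_mem (by linarith) hm hz hw
    have h2 := Nat.floor_le (a := c * (contourMass Γ' : ℝ) ^ 3 / 4) (by linarith [hfl Γ'])
    have h3 : ((⌊c * (contourMass Γ' : ℝ) ^ 3 / 4⌋₊ + ⌊c * (contourMass Γ' : ℝ) ^ 3 / 4⌋₊ : ℕ) : ℝ)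
        < ((z - w).natAbs : ℝ) := by
      push_cast
      linarith [hfl Γ']
    rw [← hm]
    exact_mod_cast h3

/-- The sites at which `ρ` is `-1` interact only weakly with the sites at a distance large compared
with their number. -/
theorem tsum_pairs_far_le {α c : ℝ} (h0 : 0 ≤ α) (hα : α < 1) (hc : 1 ≤ c) {ρ : ℤ → ℤˣ}
    {A : Finset ℤ} (hA : ∀ x, x ∈ A ↔ ρ x ≠ 1) :
    ∑' p : ℤ × ℤ, (if ρ p.1 ≠ ρ p.2 ∧ c * A.card < ((p.1 - p.2).natAbs : ℝ)
        then coupling α (p.1 - p.2).natAbs else 0)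
      ≤ 4 / (1 - α) * (c / 2) ^ (α - 1) * energy α ρ := by
  have hA' : ∀ x, x ∉ A → ρ x = 1 := fun x hx => by simpa [hA] using hx
  rw [tsum_pairs_eq (A := A)
    (summable_overlap hα hA' fun p => c * A.card < ((p.1 - p.2).natAbs : ℝ)),
    energy_eq_sum_siteEnergy hα hA, Finset.mul_sum, Finset.mul_sum]
  · refine Finset.sum_le_sum fun x hx => ?_
    have hM : (1 : ℝ) ≤ A.card := by exact_mod_cast Finset.card_pos.2 ⟨x, hx⟩
    have hs (P : ℤ → Prop) [DecidablePred P] :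
        Summable fun y => if P y then coupling α (x - y).natAbs else 0 :=
      ((summable_coupling_sub hα x).indicator {y | P y}).congr fun y => by simp [Set.indicator]
    have h1 := tsum_coupling_far_le h0 hα x (R := c * A.card) (by nlinarith)
    have h2 : ∑' y : ℤ, (if ρ x ≠ ρ y ∧ c * A.card < ((x - y).natAbs : ℝ)
          then coupling α (x - y).natAbs else 0)
        ≤ ∑' y : ℤ, (if c * A.card < ((x - y).natAbs : ℝ)
          then coupling α (x - y).natAbs else 0) := by
      refine Summable.tsum_le_tsum (fun y => ?_) (hs _) (hs _)
      have := coupling_nonneg α (x - y).natAbs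
      split_ifs with c1 c2 c2
      exacts [le_rfl, absurd c1.2 c2, this, le_rfl]
    have h3 : (c * A.card / 2) ^ (α - 1) = (c / 2) ^ (α - 1) * (A.card : ℝ) ^ (α - 1) := by
      rw [← Real.mul_rpow (by linarith) (by linarith)]
      congr 1
      ring
    have h4 := rpow_card_le_siteEnergy hα hA hx
    have h5 : 0 ≤ 4 / (1 - α) * (c / 2) ^ (α - 1) := by
      have : 0 < 1 - α := by linarith
      have : 0 ≤ c / 2 := by linarith
      positivity
    calc _ ≤ 2 * (2 / (1 - α) * ((c / 2) ^ (α - 1) * (A.card : ℝ) ^ (α - 1))) := by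
          rw [← h3]
          linarith
      _ = 4 / (1 - α) * (c / 2) ^ (α - 1) * (A.card : ℝ) ^ (α - 1) := by ring
      _ ≤ _ := mul_le_mul_of_nonneg_left h4 h5
  · intro x y
    simp only [show (y - x).natAbs = (x - y).natAbs by omega, ne_comm]
  · intro x y h
    have hxy : ρ x ≠ ρ y := by
      by_contra h'
      simp [h'] at h
    rw [hA, hA]
    rcases Int.units_eq_one_or (ρ x) with h1 | h1 <;>
      rcases Int.units_eq_one_or (ρ y) with h2 | h2 <;> simp_all

/-- The overlap of a contour with a family of contours, all of them well separated, is a small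
multiple of its energy if `c` is large. -/
theorem overlap_le_mul_energy {α c : ℝ} (h0 : 0 ≤ α) (hα : α < 1) (hc : 4 ≤ c)
    {Γ : Finset Triangle} {C : Finset (Finset Triangle)} (hne : ∀ Γ' ∈ C, Γ'.Nonempty)
    (hΓ : ∀ Γ' ∈ C, WellSeparated c Γ' Γ)
    (hC : ∀ Γ' ∈ C, ∀ Γ'' ∈ C, Γ' ≠ Γ'' → WellSeparated c Γ' Γ'') :
    overlap α (spin (C.biUnion id)) (spin Γ)
      ≤ (4 / (1 - α) * (c / 2) ^ (α - 1) + 128 / c) * energy α (spin Γ) := by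
  classical
  set ρ := spin Γ with hρ
  set τ := spin (C.biUnion id) with hτ
  set S := {Γ' ∈ C | contourMass Γ' < contourMass Γ} with hS
  have hA : ∀ x, x ∈ minusSites Γ ↔ ρ x ≠ 1 := fun x => mem_minusSites
  have hA' : ∀ x, x ∉ minusSites Γ → ρ x = 1 := fun x hx => by simpa [hA] using hx
  set far : ℤ × ℤ → ℝ := fun p =>
    if ρ p.1 ≠ ρ p.2 ∧ c * (minusSites Γ).card < ((p.1 - p.2).natAbs : ℝ)
      then coupling α (p.1 - p.2).natAbs else 0 with hfar
  set u : Finset Triangle → ℤ × ℤ → ℝ := fun Γ' p =>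
    if ρ p.1 ≠ ρ p.2 ∧ p.1 ∈ contourBase Γ' then coupling α (p.1 - p.2).natAbs else 0 with hu
  have sfar : Summable far :=
    summable_overlap hα hA' fun p => c * (minusSites Γ).card < ((p.1 - p.2).natAbs : ℝ)
  have su : ∀ Γ', Summable (u Γ') := fun Γ' => summable_overlap hα hA' fun p => p.1 ∈ contourBase Γ'
  have su' : ∀ Γ', Summable (u Γ' ∘ Equiv.prodComm ℤ ℤ) := fun Γ' =>
    (Equiv.prodComm ℤ ℤ).summable_iff.2 (su Γ')
  have far_nonneg : ∀ p, 0 ≤ far p := fun p => by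
    simp only [hfar]
    split_ifs
    exacts [coupling_nonneg _ _, le_rfl]
  have u_nonneg : ∀ Γ' p, 0 ≤ u Γ' p := fun Γ' p => by
    simp only [hu]
    split_ifs
    exacts [coupling_nonneg _ _, le_rfl]
  have u2_nonneg : ∀ Γ' p, 0 ≤ u Γ' p + (u Γ' ∘ Equiv.prodComm ℤ ℤ) p := fun Γ' p =>
    add_nonneg (u_nonneg _ _) (u_nonneg _ _)
  -- a pair of sites separated both by `Γ` and by another contour `Γ'`: if `Γ'` is larger than `Γ`,
  -- the sites are far apart, and if not, one of them lies in the base of `Γ'`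
  have hpt : ∀ p : ℤ × ℤ,
      (if ρ p.1 ≠ ρ p.2 ∧ τ p.1 ≠ τ p.2 then coupling α (p.1 - p.2).natAbs else 0)
      ≤ far p + ∑ Γ' ∈ S, (u Γ' p + (u Γ' ∘ Equiv.prodComm ℤ ℤ) p) := by
    rintro ⟨x, y⟩
    have hsum0 := Finset.sum_nonneg fun Γ' (_ : Γ' ∈ S) => u2_nonneg Γ' (x, y)
    have hf0 := far_nonneg (x, y)
    split_ifs with h
    swap
    · linarith
    obtain ⟨hρ', hτ'⟩ := h
    obtain ⟨T', hT', hsep⟩ := exists_not_mem_base_iff hτ'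
    obtain ⟨Γ', hΓ', hTΓ'⟩ := Finset.mem_biUnion.1 hT'
    rw [id] at hTΓ'
    have hsymm : (y - x).natAbs = (x - y).natAbs := by omega
    by_cases hsmall : contourMass Γ' < contourMass Γ
    · have hmem : Γ' ∈ S := Finset.mem_filter.2 ⟨hΓ', hsmall⟩
      have h1 := Finset.single_le_sum (fun Γ' (_ : Γ' ∈ S) => u2_nonneg Γ' (x, y)) hmem
      have h2 : coupling α (x - y).natAbs ≤ u Γ' (x, y) + (u Γ' ∘ Equiv.prodComm ℤ ℤ) (x, y) := by
        by_cases hx : x ∈ T'.base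
        · have hb : x ∈ contourBase Γ' := Finset.mem_biUnion.2 ⟨T', hTΓ', hx⟩
          have : u Γ' (x, y) = coupling α (x - y).natAbs := if_pos ⟨hρ', hb⟩
          have h3 := u_nonneg Γ' (y, x)
          rw [this]
          exact le_add_of_nonneg_right h3
        · have hy : y ∈ T'.base := by tauto
          have hb : y ∈ contourBase Γ' := Finset.mem_biUnion.2 ⟨T', hTΓ', hy⟩
          have : (u Γ' ∘ Equiv.prodComm ℤ ℤ) (x, y) = coupling α (y - x).natAbs :=
            if_pos ⟨Ne.symm hρ', hb⟩
          have h3 := u_nonneg Γ' (x, y)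
          rw [this, hsymm]
          exact le_add_of_nonneg_left h3
      linarith
    · have hle : contourMass Γ ≤ contourMass Γ' := not_lt.1 hsmall
      have hw := (hΓ Γ' hΓ').symm
      have hdist : c * (contourMass Γ : ℝ) ^ 3 < ((x - y).natAbs : ℝ) := by
        by_cases hx : ρ x ≠ 1
        · exact hw.lt_of_not_mem_iff (by linarith) hle
            (minusSites_subset Γ ((hA x).2 hx)) hTΓ' hsep
        · have hy : ρ y ≠ 1 := fun e => hρ' ((not_not.1 hx).trans e.symm)
          rw [← hsymm]
          exact hw.lt_of_not_mem_iff (by linarith) hle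
            (minusSites_subset Γ ((hA y).2 hy)) hTΓ' (by tauto)
      have hcard : ((minusSites Γ).card : ℝ) ≤ (contourMass Γ : ℝ) ^ 3 := by
        exact_mod_cast (card_minusSites_le Γ).trans (Nat.le_self_pow (by norm_num) _)
      have h1 : far (x, y) = coupling α (x - y).natAbs := by
        refine if_pos ⟨hρ', lt_of_le_of_lt ?_ hdist⟩
        exact mul_le_mul_of_nonneg_left hcard (by linarith)
      linarith
  have s2 : Summable fun p => ∑ Γ' ∈ S, (u Γ' p + (u Γ' ∘ Equiv.prodComm ℤ ℤ) p) :=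
    summable_sum fun Γ' _ => (su Γ').add (su' Γ')
  have h1 : overlap α τ ρ
      ≤ ∑' p, (far p + ∑ Γ' ∈ S, (u Γ' p + (u Γ' ∘ Equiv.prodComm ℤ ℤ) p)) :=
    Summable.tsum_le_tsum hpt (summable_overlap hα hA' fun p => τ p.1 ≠ τ p.2) (sfar.add s2)
  rw [sfar.tsum_add s2, Summable.tsum_finsetSum fun Γ' _ => (su Γ').add (su' Γ')] at h1
  have h2 : ∀ Γ' ∈ S, ∑' p, (u Γ' p + (u Γ' ∘ Equiv.prodComm ℤ ℤ) p)
      = 2 * ∑ z ∈ contourBase Γ', siteEnergy α ρ z := by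
    intro Γ' _
    have e := (Equiv.prodComm ℤ ℤ).tsum_eq (u Γ')
    rw [(su Γ').tsum_add (su' Γ')]
    refine (congrArg (∑' p, u Γ' p + ·) e).trans ?_
    rw [tsum_pairs_fst_mem hα hA']
    ring
  rw [Finset.sum_congr rfl h2, ← Finset.mul_sum] at h1
  have h3 := tsum_pairs_far_le h0 hα (c := c) (by linarith) hA
  have hSC : ∀ Γ' ∈ S, Γ' ∈ C := fun Γ' h => (Finset.mem_filter.1 h).1
  have h4 := sum_siteEnergy_small_le h0 hα hc (Γ := Γ) (S := S) (fun Γ' h => hne _ (hSC _ h))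
    (fun Γ' h => (Finset.mem_filter.1 h).2.le) (fun Γ' h => hΓ _ (hSC _ h))
    (fun Γ' h Γ'' h' => hC _ (hSC _ h) _ (hSC _ h'))
  calc overlap α τ ρ ≤ _ := h1
    _ ≤ 4 / (1 - α) * (c / 2) ^ (α - 1) * energy α ρ + 2 * (64 / c * energy α ρ) :=
        add_le_add h3 (mul_le_mul_of_nonneg_left h4 (by norm_num))
    _ = _ := by ring

theorem exists_forall_overlap_const_le {α : ℝ} (hα : α < 1) :
    ∃ c₀ : ℝ, 4 ≤ c₀ ∧ ∀ c, c₀ ≤ c → 4 / (1 - α) * (c / 2) ^ (α - 1) + 128 / c ≤ 1 / 2 := by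
  have h1 : Filter.Tendsto (fun c : ℝ => 4 / (1 - α) * (c / 2) ^ (α - 1) + 128 / c)
      Filter.atTop (nhds (4 / (1 - α) * 0 + 0)) := by
    refine Filter.Tendsto.add (Filter.Tendsto.const_mul _ ?_)
      (Filter.Tendsto.const_div_atTop Filter.tendsto_id _)
    have h2 := (tendsto_rpow_neg_atTop (y := 1 - α) (by linarith)).comp
      (Filter.tendsto_id.atTop_div_const (r := (2 : ℝ)) (by norm_num))
    refine h2.congr fun c => ?_
    simp only [Function.comp, id, neg_sub]
  rw [mul_zero, add_zero] at h1
  obtain ⟨c₀, h⟩ := Filter.eventually_atTop.1 (h1.eventually_le_const (u := 1 / 2) (by norm_num))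
  exact ⟨max 4 c₀, le_max_left _ _, fun c hc => h c ((le_max_right _ _).trans hc)⟩

/-! ### The two lower bounds -/

theorem mul_contourNorm_le_energy {α' α ζ : ℝ} (h : α' ≤ α) (hα : α < 1)
    (hζ : IsLowerConstant α' ζ) {Γ : Finset Triangle}
    (hΓ : ∀ T ∈ Γ, ∀ T' ∈ Γ, T ≠ T' → min T.mass T'.mass ≤ T.dist T') :
    ζ * contourNorm α' Γ ≤ energy α (spin Γ) := by
  calc ζ * contourNorm α' Γ = ∑ T ∈ Γ, ζ * chi α' T.mass := by rw [contourNorm, Finset.mul_sum]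
    _ ≤ ∑ T ∈ Γ, W α' T.mass := Finset.sum_le_sum fun T _ => hζ.2 _ (by
        have := T.mass_eq
        have := T.lt
        omega)
    _ ≤ energy α' (spin Γ) := sum_W_le_energy (h.trans_lt hα) Γ hΓ
    _ ≤ energy α (spin Γ) := energy_mono h hα fun x hx => spin_eq_one hx

/-- The two lower bounds hold for every `α' ≤ α`. -/
theorem exists_forall_mul_contourNorm_le {α : ℝ} (h0 : 0 ≤ α) (hα : α < 1) :
    ∃ c₀ : ℝ, 1 < c₀ ∧ ∀ c : ℝ, c₀ ≤ c →
      ∀ r : ℤ → ℝ, IsRootChoice r → ∀ N : ℕ,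
      ∀ G : (F : Finset Triangle) → Finpartition F, IsContourMap r N c G →
      ∀ F : Finset Triangle, IsCompatible r N F → ∀ Γ ∈ (G F).parts,
      ∀ α' ≤ α, ∀ ζ : ℝ, IsLowerConstant α' ζ →
        ζ * contourNorm α' Γ ≤ hamiltonian α {Γ} ∧
        ζ / 2 * contourNorm α' Γ ≤ condHamiltonian α Γ (G F).parts := by
  obtain ⟨c₀, h4, hc₀⟩ := exists_forall_overlap_const_le hα
  refine ⟨c₀, by linarith, fun c hc r hr N G hG F hF Γ hΓ α' hα' ζ hζ => ?_⟩
  obtain ⟨σ, -, htri⟩ := id hF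
  have hdist := (htri.min_mass_le_dist hr).2
  have hsub := (G F).le hΓ
  have hE := mul_contourNorm_le_energy hα' hα hζ (Γ := Γ) fun T hT T' hT' =>
    hdist T (hsub hT) T' (hsub hT')
  have hH : hamiltonian α {Γ} = energy α (spin Γ) := by
    rw [hamiltonian_eq_energy, Finset.singleton_biUnion, id]
  refine ⟨hH ▸ hE, ?_⟩
  set C := (G F).parts \ {Γ} with hC
  have hmem : ∀ Γ' ∈ C, Γ' ∈ (G F).parts ∧ Γ' ≠ Γ := fun Γ' h => by
    simpa [hC] using h
  have hins : (G F).parts = insert Γ C := by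
    rw [hC, Finset.sdiff_singleton_eq_erase, Finset.insert_erase hΓ]
  have hdisj : Disjoint (C.biUnion id) Γ := by
    rw [Finset.disjoint_biUnion_left]
    exact fun Γ' h => (G F).disjoint (hmem Γ' h).1 hΓ (hmem Γ' h).2
  have hspin : spin ((G F).parts.biUnion id) = spin (C.biUnion id) * spin Γ := by
    rw [← spin_union hdisj, hins, Finset.biUnion_insert, id, Finset.union_comm]
  have hov := overlap_le_mul_energy h0 hα (c := c) (by linarith) (Γ := Γ) (C := C)
    (fun Γ' h => (G F).nonempty_of_mem_parts (hmem Γ' h).1)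
    (fun Γ' h => hG.separated F hF _ (hmem Γ' h).1 _ hΓ (hmem Γ' h).2)
    (fun Γ' h Γ'' h' => hG.separated F hF _ (hmem Γ' h).1 _ (hmem Γ'' h').1)
  have hhalf : overlap α (spin (C.biUnion id)) (spin Γ) ≤ 1 / 2 * energy α (spin Γ) :=
    hov.trans (mul_le_mul_of_nonneg_right (hc₀ c hc) (energy_nonneg _ _))
  unfold condHamiltonian
  rw [← hC, hamiltonian_eq_energy, hamiltonian_eq_energy, hspin,
    energy_mul hα (fun x hx => spin_eq_one hx) (fun x hx => spin_eq_one hx)]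
  linarith

end LongRangeIsing

theorem mainTheorem4 (αstar : ℝ) (hpos : 0 < αstar) (hlt : αstar < 1)
    (hsum : HasSum (fun n : ℕ => 1 / ((n : ℝ) + 1) ^ (2 - αstar)) 2)
    (α : ℝ) (hα : α ∈ Set.Ico αstar 1) :
    ∃ α' ∈ Set.Ico 0 αstar,
      (∃ ζ : ℝ, IsLowerConstant α' ζ) ∧
      ∃ c₀ : ℝ, 1 < c₀ ∧ ∀ c : ℝ, c₀ ≤ c →
        ∀ r : ℤ → ℝ, IsRootChoice r →
        ∀ N : ℕ, 1 ≤ N →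
        ∀ G : (F : Finset Triangle) → Finpartition F, IsContourMap r N c G →
        ∀ F : Finset Triangle, IsCompatible r N F →
        ∀ Γ ∈ (G F).parts,
        ∀ ζ : ℝ, IsLowerConstant α' ζ →
          ζ * contourNorm α' Γ ≤ hamiltonian α {Γ} ∧
          ζ / 2 * contourNorm α' Γ ≤ condHamiltonian α Γ (G F).parts := by
  have h0 : 0 ≤ α := hpos.le.trans hα.1
  obtain ⟨c₀, h1, h⟩ := exists_forall_mul_contourNorm_le h0 hα.2
  exact ⟨0, ⟨le_rfl, hpos⟩, exists_isLowerConstant_zero, c₀, h1,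
    fun c hc r hr N _ G hG F hF Γ hΓ ζ hζ => h c hc r hr N G hG F hF Γ hΓ 0 h0 ζ hζ⟩
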